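/- Let $(\mathcal A,\varphi)$ be a non-commutative probability space: $\mathcal A$ is a complex unital algebra and $\varphi:\mathcal A\to\mathbb C$ is linear with $\varphi(1)=1$. Let $d,s$ be positive integers and equip $M_d(\mathcal A)$ with $\varphi_d([a_{i,j}])=\frac1d\sum_{i=1}^d\varphi(a_{i,i})$. **Notation.** $\Theta_s$ denotes the formal power series over $\mathbb C$ without constant term in non-commuting indeterminates $z_1,\dots,z_s$, and $\Theta_{sd}$ those in indeterminates $z_{r,i}$ ($1\le r\le s$, $1\le i\le d$). $NC(n)$ is the set of non-crossing partitions of $\{1,\dots,n\}$. For $\pi\in NC(n)$, $P_\pi$ is the permutation whose cycles are the blocks of $\pi$, each run through in increasing order, and the Kreweras complement $\mathrm{Kr}(\pi)$ is determined by $P_\pi\circ P_{\mathrm{Kr}(\pi)}=(1\,2\,\cdots\,n)$. Write $[\mathrm{coef}\,w](f)$ for the coefficient of a word $w$ in $f$ and $[\mathrm{coef}\,w;\pi](f)=\prod_{B\in\pi}[\mathrm{coef}\,w|B](f)$. The boxed convolution of $f,g\in\Theta_s$ is $$[\mathrm{coef}(r_1,\dots,r_n)](f\star g)=\sum_{\pi\in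 NC(n)}[\mathrm{coef}(r_1,\dots,r_n);\pi](f)\,[\mathrm{coef}(r_1,\dots,r_n);\mathrm{Kr}(\pi)](g),$$ and for $f\in\Theta_{sd}$, $g\in\Theta_d$ the extended boxed convolution $f\,\tilde\star\,g\in\Theta_{sd}$ is $$[\mathrm{coef}((r_1,i_1),\dots,(r_n,i_n))](f\,\tilde\star\,g)=\sum_{\pi\in NC(n)}[\mathrm{coef}((r_1,i_1),\dots,(r_n,i_n));\pi](f)\,[\mathrm{coef}(i_1,\dots,i_n);\mathrm{Kr}(\pi)](g).$$ $\mathrm{M\ddot ob}_s\in\Theta_s$ is the inverse under $\star$ of the series all of whose coefficients (in degrees $n\ge1$) equal $1$. Put $$G_d=\sum_{n\ge1}\sum_{i=1}^d z_i^n,\qquad H_d=G_d\star\bigl(d\cdot\mathrm{M\ddot ob}_d(\tfrac1d z_1,\dots,\tfrac1d z_d)\bigr).$$ For elements $a_1,\dots,a_s$ of a non-commutative probability space $(\mathcal B,\psi)$, the moment series is $M_{a_1,\dots,a_s}=\sum_{n\ge1}\sum_{r_1,\dots,r_n}\psi(a_{r_1}\cdots a_{r_n})z_{r_1}\cdots z_{r_n}$,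 the R-transform is $R_{a_1,\dots,a_s}=M_{a_1,\dots,a_s}\star\mathrm{M\ddot ob}_s$, and $k_n(a_{r_1},\dots,a_{r_n})$ is the coefficient of $z_{r_1}\cdots z_{r_n}$ in $R_{a_1,\dots,a_s}$. Matrices $A_r=[a^{(r)}_{i,j}]\in M_d(\mathcal A)$, $1\le r\le s$, form an *R-cyclic family* if $k_n(a^{(r_1)}_{i_1,j_1},\dots,a^{(r_n)}_{i_n,j_n})=0$ for all $n\ge1$ and all indices for which it is not true that $j_1=i_2,\dots,j_{n-1}=i_n,\ j_n=i_1$. The *determining series* of such a family is $$f=\sum_{n\ge1}\ \sum_{i_1,\dots,i_n=1}^d\ \sum_{r_1,\dots,r_n=1}^s k_n(a^{(r_1)}_{i_n,i_1},a^{(r_2)}_{i_1,i_2},\dots,a^{(r_n)}_{i_{n-1},i_n})\,z_{r_1,i_1}\cdots z_{r_n,i_n}\in\Theta_{sd}.$$ For a single matrix $A$ the index $r$ is omitted; $A$ is then called an *R-cyclic matrix*, and $f\in\Theta_d$. **Theorem.** (a) If $A_1,\dots,A_s$ is an R-cyclic family in $M_d(\mathcal A)$ with determining series $f$, then, in $(M_d(\mathcal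 A),\varphi_d)$, $$M_{A_1,\dots,A_s}(z_1,\dots,z_s)=\tfrac1d\,(f\,\tilde\star\,G_d)(\underbrace{z_1,\dots,z_1}_{d},\dots,\underbrace{z_s,\dots,z_s}_{d}),$$ $$R_{A_1,\dots,A_s}(z_1,\dots,z_s)=\tfrac1d\,(f\,\tilde\star\,H_d)(\underbrace{z_1,\dots,z_1}_{d},\dots,\underbrace{z_s,\dots,z_s}_{d}).$$ (b) If $A\in M_d(\mathcal A)$ is an R-cyclic matrix with determining series $f\in\Theta_d$, then $$M_A(z)=\tfrac1d\,(f\star G_d)(\underbrace{z,\dots,z}_{d}),\qquad R_A(z)=\tfrac1d\,(f\star H_d)(\underbrace{z,\dots,z}_{d}).$$ -/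

import Mathlib

open scoped BigOperators

namespace FreeProb

noncomputable section

/-! ### Non-crossing partitions and the Kreweras complement -/

/-- Partitions of `{1, …, n}`, modelled on `Fin n`. -/
abbrev SetPartition (n : ℕ) : Type := Finpartition (Finset.univ : Finset (Fin n))

/-- `π` is non-crossing: whenever `i < j < k < l`, `i` is in the block of `k` and `j` is in the
block of `l`, all four are in the same block. -/
def IsNonCrossing {n : ℕ} (π : SetPartition n) : Prop :=
  ∀ i j k l : Fin n, i < j → j < k → k < l →
    π.part i = π.part k → π.part j = π.part l → π.part i = π.part j

instance {n : ℕ} : DecidablePred (IsNonCrossing (n := n)) := fun π => by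
  unfold IsNonCrossing; infer_instance

/-- The set `NC(n)` of non-crossing partitions of `{1, …, n}`. -/
def NC (n : ℕ) : Finset (SetPartition n) := Finset.univ.filter IsNonCrossing

/-- The cycle `k₁ ↦ k₂ ↦ ⋯ ↦ k_p ↦ k₁` attached to a set `B = {k₁ < k₂ < ⋯ < k_p}`. -/
def blockCycle {n : ℕ} (B : Finset (Fin n)) : Equiv.Perm (Fin n) :=
  (B.sort (· ≤ ·)).formPerm

theorem blockCycle_mem_iff {n : ℕ} (B : Finset (Fin n)) (k : Fin n) :
    blockCycle B k ∈ B ↔ k ∈ B := by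
  have h := List.formPerm_mem_iff_mem (l := B.sort (· ≤ ·)) (x := k)
  rwa [Finset.mem_sort, Finset.mem_sort] at h

theorem blockCycle_symm_mem_iff {n : ℕ} (B : Finset (Fin n)) (k : Fin n) :
    (blockCycle B).symm k ∈ B ↔ k ∈ B := by
  rw [← blockCycle_mem_iff B ((blockCycle B).symm k), Equiv.apply_symm_apply]

/-- The permutation of `{1, …, n}` having the blocks of `π` as cycles, each block being run
through in increasing order. -/
def partitionPerm {n : ℕ} (π : SetPartition n) : Equiv.Perm (Fin n) where
  toFun k := blockCycle (π.part k) k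
  invFun k := (blockCycle (π.part k)).symm k
  left_inv k := by
    have h : π.part (blockCycle (π.part k) k) = π.part k :=
      π.part_eq_of_mem (π.part_mem.2 (Finset.mem_univ k))
        ((blockCycle_mem_iff _ _).2 (π.mem_part_self.2 (Finset.mem_univ k)))
    simp [h]
  right_inv k := by
    have h : π.part ((blockCycle (π.part k)).symm k) = π.part k :=
      π.part_eq_of_mem (π.part_mem.2 (Finset.mem_univ k))
        ((blockCycle_symm_mem_iff _ _).2 (π.mem_part_self.2 (Finset.mem_univ k)))
    simp [h]

/-- The partition of `{1, …, n}` into the cycles (orbits) of a permutation. -/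
def cyclePartition {n : ℕ} (τ : Equiv.Perm (Fin n)) : SetPartition n :=
  letI : DecidableRel (Equiv.Perm.SameCycle.setoid τ).r :=
    inferInstanceAs (DecidableRel (Equiv.Perm.SameCycle τ))
  Finpartition.ofSetoid (Equiv.Perm.SameCycle.setoid τ)

/-- The Kreweras complement, determined by `perm_π ∘ perm_{Kr π} = γ_n` where `γ_n = finRotate n`
is the forward cycle: the blocks of `Kr π` are the cycles of `perm_π⁻¹ ∘ γ_n`. -/
def kreweras {n : ℕ} (π : SetPartition n) : SetPartition n :=
  cyclePartition ((partitionPerm π)⁻¹ * finRotate n)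

/-! ### Power series in non-commuting indeterminates -/

/-- `Theta ι` is the space of complex power series without constant term in non-commuting
indeterminates `z_r`, `r ∈ ι`. The coefficient of `z_{w 0} z_{w 1} ⋯ z_{w (n-1)}` in `f` is
`f.1 n w`. -/
def Theta (ι : Type*) : Submodule ℂ ((n : ℕ) → (Fin n → ι) → ℂ) where
  carrier := {f | ∀ w, f 0 w = 0}
  add_mem' hf hg w := by simp [hf w, hg w]
  zero_mem' _ := rfl
  smul_mem' c f hf w := by simp [hf w]

variable {ι κ σ δ : Type*}

/-- The coefficient of `z_{w 0} ⋯ z_{w (n-1)}` in `f`. -/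
def coeff (f : Theta ι) {n : ℕ} (w : Fin n → ι) : ℂ := f.1 n w

/-- The series in `Theta ι` with prescribed coefficients in degrees `n ≥ 1`. -/
def mkSeries (c : (n : ℕ) → (Fin n → ι) → ℂ) : Theta ι :=
  ⟨fun n w => if n = 0 then 0 else c n w, fun w => by simp⟩

/-- The restricted word `(w₁, …, w_n) | B`. -/
def restrictWord {n : ℕ} (w : Fin n → ι) (B : Finset (Fin n)) : Fin B.card → ι :=
  fun k => w (B.orderEmbOfFin rfl k)

/-- The generalized coefficient `[coef (w₁, …, w_n); π] (f)`, the product over the blocks `B` of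
`π` of the coefficients `[coef (w₁, …, w_n) | B] (f)`. -/
def genCoeff (f : Theta ι) {n : ℕ} (w : Fin n → ι) (π : SetPartition n) : ℂ :=
  ∏ B ∈ π.parts, coeff f (restrictWord w B)

/-- The boxed convolution `f ⋆ g` of two series in the same indeterminates. -/
def boxConv (f g : Theta ι) : Theta ι :=
  mkSeries fun n w => ∑ π ∈ NC n, genCoeff f w π * genCoeff g w (kreweras π)

/-- The extended boxed convolution of a series `f` in the indeterminates `z_{r,i}` with a series
`g` in the indeterminates `z_i`. -/
def extBoxConv (f : Theta (σ × δ)) (g : Theta δ) : Theta (σ × δ) :=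
  mkSeries fun n w =>
    ∑ π ∈ NC n, genCoeff f w π * genCoeff g (fun k => (w k).2) (kreweras π)

/-- The dilation `f ∘ D_α`, i.e. `f` evaluated at `(α z_r)_r`. -/
def dilate (α : ℂ) (f : Theta ι) : Theta ι := mkSeries fun n w => α ^ n * coeff f w

/-- The series in the indeterminates `z_b`, `b ∈ κ`, obtained from `f` by substituting `z_{p a}`
for the indeterminate `z_a`, for every `a ∈ ι`. -/
def substVars [Fintype ι] [DecidableEq κ] (p : ι → κ) (f : Theta ι) : Theta κ :=
  mkSeries fun n w => ∑ v : Fin n → ι with (fun k => p (v k)) = w, coeff f v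

/-- The zeta series: every coefficient of degree at least one equals `1`. -/
def zetaSeries (ι : Type*) : Theta ι := mkSeries fun _ _ => 1

/-- The unit `∑ z_r` for the boxed convolution. -/
def deltaSeries (ι : Type*) : Theta ι := mkSeries fun n _ => if n = 1 then 1 else 0

/-- The coefficients of the Möbius series; they depend only on the degree `n`, and are determined
recursively by `∑_{π ∈ NC(n)} ∏_{B ∈ π} m_{|B|} = δ_{n,1}` for `n ≥ 1`. The partition with the
single block `{1, …, n}` is the only one having a block with at least `n` elements. -/
def moebNumber (n : ℕ) : ℂ :=
  (if n = 1 then 1 else 0) -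
    ∑ π ∈ (NC n).filter (fun π => π.parts ≠ {Finset.univ}),
      ∏ B ∈ π.parts, if _h : B.card < n then moebNumber B.card else 0
termination_by n

/-- The Möbius series: the inverse of the zeta series under boxed convolution (its coefficients are
determined by `Möb ⋆ Zeta = Δ`, see `moebSeries_boxConv_zetaSeries`). -/
def moebSeries (ι : Type*) : Theta ι := mkSeries fun n _ => moebNumber n

theorem card_pos_of_mem_parts {n : ℕ} (π : SetPartition n) {B : Finset (Fin n)}
    (hB : B ∈ π.parts) : B.card ≠ 0 :=
  (Finset.card_pos.2 (π.nonempty_of_mem_parts hB)).ne'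

theorem genCoeff_zetaSeries {n : ℕ} (w : Fin n → ι) (π : SetPartition n) :
    genCoeff (zetaSeries ι) w π = 1 :=
  Finset.prod_eq_one fun B hB => by
    simp [coeff, zetaSeries, mkSeries, card_pos_of_mem_parts π hB]

theorem genCoeff_moebSeries {n : ℕ} (w : Fin n → ι) (π : SetPartition n) :
    genCoeff (moebSeries ι) w π = ∏ B ∈ π.parts, moebNumber B.card :=
  Finset.prod_congr rfl fun B hB => by
    simp [coeff, moebSeries, mkSeries, card_pos_of_mem_parts π hB]

theorem card_lt_of_parts_ne {n : ℕ} (π : SetPartition n) (h : π.parts ≠ {Finset.univ})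
    {B : Finset (Fin n)} (hB : B ∈ π.parts) : B.card < n := by
  have hne : B ≠ Finset.univ := by
    rintro rfl
    refine h (Finset.eq_singleton_iff_unique_mem.2 ⟨hB, fun C hC => ?_⟩)
    obtain ⟨x, hx⟩ := π.nonempty_of_mem_parts hC
    exact π.eq_of_mem_parts hC hB hx (Finset.mem_univ x)
  simpa using Finset.card_lt_card (Finset.ssubset_univ_iff.2 hne)

theorem sum_NC_moebNumber (n : ℕ) (hn : n ≠ 0) :
    ∑ π ∈ NC n, ∏ B ∈ π.parts, moebNumber B.card = if n = 1 then 1 else 0 := by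
  have huniv : (Finset.univ : Finset (Fin n)) ≠ ⊥ := by
    have : NeZero n := ⟨hn⟩
    exact (Finset.univ_nonempty).ne_empty
  have htop : (NC n).filter (fun π => ¬ π.parts ≠ {Finset.univ}) =
      {Finpartition.indiscrete huniv} := by
    ext π
    simp only [Finset.mem_filter, Finset.mem_singleton, not_not, NC, Finset.mem_univ, true_and]
    constructor
    · rintro ⟨-, h⟩
      exact Finpartition.ext (by simpa using h)
    · rintro rfl
      refine ⟨fun i j _ _ _ _ _ _ _ => ?_, rfl⟩
      have hp : ∀ x : Fin n, (Finpartition.indiscrete huniv).part x = Finset.univ := fun x =>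
        (Finpartition.indiscrete huniv).part_eq_of_mem (by simp) (Finset.mem_univ x)
      rw [hp, hp]
  rw [← Finset.sum_filter_add_sum_filter_not (NC n) (fun π => π.parts ≠ {Finset.univ}), htop,
    Finset.sum_singleton, Finpartition.indiscrete_parts, Finset.prod_singleton,
    Finset.card_univ, Fintype.card_fin, moebNumber]
  have : ∀ π ∈ (NC n).filter (fun π => π.parts ≠ {Finset.univ}),
      (∏ B ∈ π.parts, moebNumber B.card) =
        ∏ B ∈ π.parts, if _h : B.card < n then moebNumber B.card else 0 := fun π hπ =>
    Finset.prod_congr rfl fun B hB => by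
      simp [card_lt_of_parts_ne π (Finset.mem_filter.1 hπ).2 hB]
  rw [Finset.sum_congr rfl this]
  ring

/-- `Möb ⋆ Zeta = Δ`. -/
theorem moebSeries_boxConv_zetaSeries (ι : Type*) :
    boxConv (moebSeries ι) (zetaSeries ι) = deltaSeries ι := by
  refine Subtype.ext (funext fun n => funext fun w => ?_)
  by_cases hn : n = 0
  · simp [boxConv, deltaSeries, mkSeries, hn]
  · simp only [boxConv, deltaSeries, mkSeries, if_neg hn, genCoeff_zetaSeries,
      genCoeff_moebSeries, mul_one]
    exact sum_NC_moebNumber n hn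

/-- The geometric series `G_d = ∑_{n ≥ 1} ∑_i z_i ^ n` in separate indeterminates. -/
def geomSeries (d : ℕ) : Theta (Fin d) :=
  mkSeries fun _ w => if ∃ i, ∀ k, w k = i then 1 else 0

/-- The series `H_d = G_d ⋆ (d · Möb_d ∘ D_{1/d})`. -/
def hSeries (d : ℕ) : Theta (Fin d) :=
  boxConv (geomSeries d) ((d : ℂ) • dilate (1 / (d : ℂ)) (moebSeries (Fin d)))

/-! ### Moment series, R-transforms, R-cyclic matrices -/

section Probability

variable {A : Type*} [Ring A] [Algebra ℂ A]

/-- The moment series of a family `(a_r)` with respect to the expectation `φ`: the coefficient of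
`z_{r₁} ⋯ z_{r_n}` is `φ (a_{r₁} ⋯ a_{r_n})`. -/
def momentSeries (φ : A →ₗ[ℂ] ℂ) (a : ι → A) : Theta ι :=
  mkSeries fun _ w => φ (List.ofFn fun k => a (w k)).prod

/-- The R-transform `R = M ⋆ Möb` of a family. Its coefficients are the free cumulants
`k_n (a_{r₁}, …, a_{r_n})`. -/
def rTransform (φ : A →ₗ[ℂ] ℂ) (a : ι → A) : Theta ι :=
  boxConv (momentSeries φ a) (moebSeries ι)

/-- The expectation `φ_d [a_{i,j}] = (1/d) ∑_i φ (a_{i,i})` on `d × d` matrices. -/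
def matrixExpectation (φ : A →ₗ[ℂ] ℂ) (d : ℕ) : Matrix (Fin d) (Fin d) A →ₗ[ℂ] ℂ where
  toFun X := (1 / (d : ℂ)) * ∑ i, φ (X i i)
  map_add' X Y := by simp [Finset.sum_add_distrib, mul_add]
  map_smul' c X := by simp [← Finset.mul_sum, mul_left_comm]

theorem matrixExpectation_one (φ : A →ₗ[ℂ] ℂ) (hφ : φ 1 = 1) {d : ℕ} (hd : 0 < d) :
    matrixExpectation φ d 1 = 1 := by
  have : (d : ℂ) ≠ 0 := Nat.cast_ne_zero.2 hd.ne'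
  simp [matrixExpectation, hφ, this]

/-- The R-transform of the entries `a_{i,j}` of a matrix. -/
def entryRTransform (φ : A →ₗ[ℂ] ℂ) {d : ℕ} (X : Matrix (Fin d) (Fin d) A) :
    Theta (Fin d × Fin d) :=
  rTransform φ fun e => X e.1 e.2

/-- A matrix is R-cyclic if `k_n (a_{i₁,j₁}, …, a_{i_n,j_n}) = 0` unless
`j₁ = i₂, …, j_{n-1} = i_n, j_n = i₁`. -/
def IsRCyclic (φ : A →ₗ[ℂ] ℂ) {d : ℕ} (X : Matrix (Fin d) (Fin d) A) : Prop :=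
  ∀ n : ℕ, 1 ≤ n → ∀ i j : Fin n → Fin d,
    ¬ (∀ k, j k = i (finRotate n k)) →
      coeff (entryRTransform φ X) (fun k => (i k, j k)) = 0

/-- The determining series of a matrix: the coefficient of `z_{i₁} ⋯ z_{i_n}` is
`k_n (a_{i_n,i₁}, a_{i₁,i₂}, …, a_{i_{n-1},i_n})`. -/
def determiningSeries (φ : A →ₗ[ℂ] ℂ) {d : ℕ} (X : Matrix (Fin d) (Fin d) A) : Theta (Fin d) :=
  mkSeries fun n i => coeff (entryRTransform φ X) fun k => (i ((finRotate n).symm k), i k)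

/-- The R-transform of all the entries `a_{i,j}^{(r)}` of a family of matrices. -/
def familyEntryRTransform (φ : A →ₗ[ℂ] ℂ) {s d : ℕ} (X : Fin s → Matrix (Fin d) (Fin d) A) :
    Theta (Fin s × Fin d × Fin d) :=
  rTransform φ fun e => X e.1 e.2.1 e.2.2

/-- A family of matrices is R-cyclic if `k_n (a_{i₁,j₁}^{(r₁)}, …, a_{i_n,j_n}^{(r_n)}) = 0`
unless `j₁ = i₂, …, j_{n-1} = i_n, j_n = i₁`. -/
def IsRCyclicFamily (φ : A →ₗ[ℂ] ℂ) {s d : ℕ} (X : Fin s → Matrix (Fin d) (Fin d) A) : Prop :=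
  ∀ n : ℕ, 1 ≤ n → ∀ (r : Fin n → Fin s) (i j : Fin n → Fin d),
    ¬ (∀ k, j k = i (finRotate n k)) →
      coeff (familyEntryRTransform φ X) (fun k => (r k, i k, j k)) = 0

/-- The determining series of a family of matrices: the coefficient of
`z_{r₁,i₁} ⋯ z_{r_n,i_n}` is
`k_n (a_{i_n,i₁}^{(r₁)}, a_{i₁,i₂}^{(r₂)}, …, a_{i_{n-1},i_n}^{(r_n)})`. -/
def familyDeterminingSeries (φ : A →ₗ[ℂ] ℂ) {s d : ℕ} (X : Fin s → Matrix (Fin d) (Fin d) A) :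
    Theta (Fin s × Fin d) :=
  mkSeries fun n w => coeff (familyEntryRTransform φ X) fun k =>
    ((w k).1, (w ((finRotate n).symm k)).2, (w k).2)

end Probability

end

end FreeProb

namespace FreeProb

noncomputable section

/-! ### The Kreweras complement through separated intervals -/

namespace SetPartition

variable {n : ℕ}

/-! Expand `φ_d (A_{r₁} ⋯ A_{r_n})` as an average over closed index paths, and each resulting moment
of entries as a sum over π ∈ NC(n) of products of cumulants. R-cyclicity kills the product for π
unless, in every block, the second index at a position equals the first index at the cyclically next
position of the block. On a closed path this says that the index word is constant along the cycles
of P_π⁻¹γ, γ = (1 2 ⋯ n), that is, on the blocks of Kr(π). What survives is the generalized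
coefficient of f at π, and the constancy condition is the generalized coefficient of G_d at Kr(π).
This is `genCoeff_closedPath`; it gives the moment formula.

The R-transform formula follows on convolving with Möb. Identifying indeterminates is compatible
with this, and |π| + |Kr(π)| = n + 1 turns (1/d)^|π| into 1/d times the scalings of d·Möb_d(z/d)
(`conv_smul_substVars_moebSeries`); associativity then produces H_d.

Associativity (`conv_assoc`), which also inverts R = M ⋆ Möb, is the combinatorial core. It rests on
the description of Kr(σ) by intervals, k and l being in one block exactly when (k, l] cuts no block
of σ (`kreweras_part_eq_iff`), and on the identity that the complement of Kr_π(σ) inside Kr(σ) is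
Kr(π) (`relKreweras_kreweras_relKreweras`). -/

theorem ext_part {π σ : SetPartition n}
    (h : ∀ x y, π.part x = π.part y ↔ σ.part x = σ.part y) : π = σ := by
  have hpart : ∀ x, π.part x = σ.part x := fun x => by
    ext y
    rw [π.mem_part_iff_part_eq_part (Finset.mem_univ _) (Finset.mem_univ _),
      σ.mem_part_iff_part_eq_part (Finset.mem_univ _) (Finset.mem_univ _)]
    exact h y x
  refine Finpartition.ext ?_
  ext B
  constructor
  · intro hB
    obtain ⟨x, hx⟩ := π.nonempty_of_mem_parts hB
    rw [← π.part_eq_of_mem hB hx, hpart]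
    exact σ.part_mem.2 (Finset.mem_univ x)
  · intro hB
    obtain ⟨x, hx⟩ := σ.nonempty_of_mem_parts hB
    rw [← σ.part_eq_of_mem hB hx, ← hpart]
    exact π.part_mem.2 (Finset.mem_univ x)

theorem mem_part_iff (π : SetPartition n) {x y : Fin n} :
    x ∈ π.part y ↔ π.part x = π.part y :=
  π.mem_part_iff_part_eq_part (Finset.mem_univ _) (Finset.mem_univ _)

theorem part_mem_parts (π : SetPartition n) (x : Fin n) : π.part x ∈ π.parts :=
  π.part_mem.2 (Finset.mem_univ x)

theorem self_mem_part (π : SetPartition n) (x : Fin n) : x ∈ π.part x :=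
  π.mem_part_self.2 (Finset.mem_univ x)

theorem mem_of_part_eq (π : SetPartition n) {B : Finset (Fin n)} (hB : B ∈ π.parts) {x y : Fin n}
    (hx : x ∈ B) (h : π.part x = π.part y) : y ∈ B := by
  rw [← π.part_eq_of_mem hB hx, h]
  exact π.self_mem_part y

theorem part_eq_part_of_mem (π : SetPartition n) {B : Finset (Fin n)} (hB : B ∈ π.parts)
    {x y : Fin n} (hx : x ∈ B) (hy : y ∈ B) : π.part x = π.part y := by
  rw [π.part_eq_of_mem hB hx, π.part_eq_of_mem hB hy]

/-- The partition into the classes of an equivalence relation. -/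
def ofRel (s : Setoid (Fin n)) : SetPartition n :=
  letI : DecidableRel s.r := Classical.decRel _
  Finpartition.ofSetoid s

theorem ofRel_part_eq_iff (s : Setoid (Fin n)) {x y : Fin n} :
    (ofRel s).part x = (ofRel s).part y ↔ s x y := by
  let : DecidableRel s.r := Classical.decRel _
  rw [← mem_part_iff, ofRel, Finpartition.mem_part_ofSetoid_iff_rel]
  exact ⟨fun h => s.symm h, fun h => s.symm h⟩

end SetPartition

/-! ### The permutation P_π and the blocks of Kr(π) -/

variable {n : ℕ}

theorem cyclePartition_part_eq_iff (τ : Equiv.Perm (Fin n)) {x y : Fin n} :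
    (cyclePartition τ).part x = (cyclePartition τ).part y ↔ τ.SameCycle x y := by
  let : DecidableRel (Equiv.Perm.SameCycle.setoid τ).r :=
    inferInstanceAs (DecidableRel (Equiv.Perm.SameCycle τ))
  rw [← SetPartition.mem_part_iff, cyclePartition, Finpartition.mem_part_ofSetoid_iff_rel]
  exact ⟨fun h => h.symm, fun h => h.symm⟩

theorem mem_NC {π : SetPartition n} : π ∈ NC n ↔ IsNonCrossing π := by simp [NC]

theorem val_finRotate (k : Fin n) :
    (finRotate n k : ℕ) = if (k : ℕ) + 1 = n then 0 else (k : ℕ) + 1 := by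
  obtain _ | m := n
  · exact k.elim0
  · rw [coe_finRotate]
    simp [Fin.ext_iff]

theorem finRotate_castSucc {m : ℕ} (k : Fin m) :
    finRotate (m + 1) k.castSucc = k.succ := by
  ext
  rw [val_finRotate, if_neg (by simp; omega)]
  simp

/-- `P_π` sends an element of a block to the cyclically next one. -/
theorem partitionPerm_orderEmbOfFin (π : SetPartition n) {B : Finset (Fin n)} (hB : B ∈ π.parts)
    (t : Fin B.card) :
    partitionPerm π (B.orderEmbOfFin rfl t) = B.orderEmbOfFin rfl (finRotate B.card t) := by
  have hpart : π.part (B.orderEmbOfFin rfl t) = B :=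
    π.part_eq_of_mem hB (B.orderEmbOfFin_mem rfl t)
  change blockCycle (π.part (B.orderEmbOfFin rfl t)) _ = _
  rw [hpart, blockCycle, Finset.orderEmbOfFin_apply, Finset.orderEmbOfFin_apply]
  have hlen : (B.sort (· ≤ ·)).length = B.card := Finset.length_sort _
  have := List.formPerm_apply_getElem (B.sort (· ≤ ·)) (B.sort_nodup (· ≤ ·)) t
    (by rw [hlen]; exact t.2)
  refine this.trans ?_
  congr 1
  rw [val_finRotate, hlen]
  split_ifs with h
  · rw [h, Nat.mod_self]
  · exact Nat.mod_eq_of_lt (by have := t.2; omega)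

theorem exists_orderEmbOfFin_eq {B : Finset (Fin n)} {x : Fin n} (hx : x ∈ B) :
    ∃ t, B.orderEmbOfFin rfl t = x := by
  have : x ∈ Set.range (B.orderEmbOfFin rfl) := by
    rw [Finset.range_orderEmbOfFin]
    exact hx
  exact this

theorem part_partitionPerm (π : SetPartition n) (p : Fin n) :
    π.part (partitionPerm π p) = π.part p := by
  obtain ⟨t, ht⟩ := exists_orderEmbOfFin_eq (π.self_mem_part p)
  rw [← ht, partitionPerm_orderEmbOfFin π (π.part_mem_parts p)]
  exact π.part_eq_part_of_mem (π.part_mem_parts p) (Finset.orderEmbOfFin_mem _ _ _)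
    (Finset.orderEmbOfFin_mem _ _ _)

/-- The cyclically next element of a block. -/
theorem partitionPerm_next (π : SetPartition n) (p : Fin n) :
    (p < partitionPerm π p ∧
        ∀ z, π.part z = π.part p → p < z → partitionPerm π p ≤ z) ∨
      (partitionPerm π p ≤ p ∧
        ∀ z, π.part z = π.part p → partitionPerm π p ≤ z ∧ z ≤ p) := by
  obtain ⟨t, ht⟩ := exists_orderEmbOfFin_eq (π.self_mem_part p)
  have hB := π.part_mem_parts p
  have hP := partitionPerm_orderEmbOfFin π hB t
  rw [ht] at hP
  have hval := val_finRotate t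
  have key : ∀ z, π.part z = π.part p → ∃ r, (π.part p).orderEmbOfFin rfl r = z := fun z hz =>
    exists_orderEmbOfFin_eq (π.mem_part_iff.2 hz)
  split_ifs at hval with h
  · right
    have hall : ∀ r, finRotate _ t ≤ r ∧ r ≤ t := fun r => by
      rw [Fin.le_def, Fin.le_def]
      have := r.2
      omega
    rw [hP]
    refine ⟨?_, fun z hz => ?_⟩
    · conv_rhs => rw [← ht]
      exact (OrderEmbedding.le_iff_le _).2 (hall t).1
    · obtain ⟨r, rfl⟩ := key z hz
      refine ⟨(OrderEmbedding.le_iff_le _).2 (hall r).1, ?_⟩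
      conv_rhs => rw [← ht]
      exact (OrderEmbedding.le_iff_le _).2 (hall r).2
  · left
    rw [hP]
    refine ⟨?_, fun z hz hpz => ?_⟩
    · conv_lhs => rw [← ht]
      rw [OrderEmbedding.lt_iff_lt, Fin.lt_def]
      omega
    · obtain ⟨r, rfl⟩ := key z hz
      conv_lhs at hpz => rw [← ht]
      rw [OrderEmbedding.lt_iff_lt, Fin.lt_def] at hpz
      rw [OrderEmbedding.le_iff_le, Fin.le_def]
      omega

/-- No block of `σ` separates `k` from `l`: every block lies inside or outside of the interval
between `k` (excluded) and `l` (included). -/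
def Unseparated (σ : SetPartition n) (k l : Fin n) : Prop :=
  ∀ u v, σ.part u = σ.part v → ((u ≤ k ↔ u ≤ l) ↔ (v ≤ k ↔ v ≤ l))

theorem Unseparated.refl (σ : SetPartition n) (k : Fin n) : Unseparated σ k k :=
  fun _ _ _ => by simp

theorem Unseparated.symm {σ : SetPartition n} {k l : Fin n} (h : Unseparated σ k l) :
    Unseparated σ l k := fun u v huv => by
  have := h u v huv
  tauto

theorem Unseparated.trans {σ : SetPartition n} {k l m : Fin n} (h : Unseparated σ k l)
    (h' : Unseparated σ l m) : Unseparated σ k m := fun u v huv => by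
  have h1 := h u v huv
  have h2 := h' u v huv
  clear h h' huv
  generalize (u ≤ k) = a1, (u ≤ l) = a2, (u ≤ m) = a3, (v ≤ k) = b1, (v ≤ l) = b2,
    (v ≤ m) = b3 at *
  by_cases a1 <;> by_cases a2 <;> by_cases a3 <;> by_cases b1 <;> by_cases b2 <;> simp_all

/-- The condition `u ≤ k ↔ u ≤ l` says that u lies outside the interval between k and l. It is
symmetric in k and l, which makes the equivalence relation laws propositional; here the order of k
and l is known and the interval is (k, l]. -/
theorem unseparated_iff_of_le {σ : SetPartition n} {k l : Fin n} (hkl : k ≤ l) :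
    Unseparated σ k l ↔ ∀ u v, σ.part u = σ.part v → k < u → u ≤ l → k < v ∧ v ≤ l := by
  have key : ∀ u : Fin n, ¬ (u ≤ k ↔ u ≤ l) ↔ k < u ∧ u ≤ l := fun u => by
    constructor
    · intro h
      by_contra h'
      apply h
      constructor <;> intro h'' <;> by_contra <;> apply h' <;> omega
    · rintro ⟨h1, h2⟩ h
      omega
  constructor
  · intro h u v huv h1 h2
    rw [← key, ← h u v huv, key]
    exact ⟨h1, h2⟩
  · intro h u v huv
    rw [← not_iff_not, key, key]
    exact ⟨fun hu => h u v huv hu.1 hu.2, fun hv => h v u huv.symm hv.1 hv.2⟩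

/-- If `q = k + 1` (cyclically) follows `p` in a block of `σ`, then `k` and `p` are
unseparated. -/
theorem unseparated_of_partitionPerm_eq {σ : SetPartition n} (hσ : IsNonCrossing σ) {k p : Fin n}
    (h : partitionPerm σ p = finRotate n k) : Unseparated σ k p := by
  have hpart := part_partitionPerm σ p
  have hnext := partitionPerm_next σ p
  have hval := val_finRotate k
  rw [h] at hpart hnext
  generalize finRotate n k = q at *
  have hkn := k.2
  -- If p < q, the interval (p, k] is the gap between two consecutive elements of a block. Otherwise
  -- p is the maximum and q the minimum of the block, and the interval is the tail after p (when q
  -- is the first position) or the span [q, p]. Another block cut by it would cross the block of p.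
  rcases hnext with ⟨hpq, hz⟩ | ⟨hpq, hz⟩
  · have hpk : p ≤ k := by
      split_ifs at hval <;> omega
    refine Unseparated.symm ((unseparated_iff_of_le hpk).2 fun u v huv h1 h2 => ?_)
    have huq : u < q := by split_ifs at hval <;> omega
    have hup : σ.part u ≠ σ.part p := fun e => absurd (hz u e h1) (by omega)
    by_contra hv
    have hvp : v ≠ p := fun e => hup (by rw [huv, e])
    have hvq : v ≠ q := fun e => hup (by rw [huv, e, hpart])
    have hv' : v < p ∨ q < v := by
      split_ifs at hval <;> omega
    rcases hv' with hv' | hv'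
    · exact hup (huv.trans (hσ v p u q hv' h1 huq huv.symm hpart.symm))
    · exact hup (hσ p u q v h1 huq hv' hpart.symm huv).symm
  · split_ifs at hval with hk
    · have hpk : p ≤ k := by omega
      refine Unseparated.symm ((unseparated_iff_of_le hpk).2 fun u v huv h1 h2 => ?_)
      have hup : σ.part u ≠ σ.part p := fun e => absurd (hz u e).2 (by omega)
      by_contra hv
      have hvp : v ≠ p := fun e => hup (by rw [huv, e])
      have hvq : v ≠ q := fun e => hup (by rw [huv, e, hpart])
      have hv1 : v < p := by omega
      have hv2 : q < v := by omega
      exact hup (huv.trans ((hσ q v p u hv2 hv1 h1 hpart huv.symm).symm.trans hpart))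
    · have hkp : k ≤ p := by omega
      refine (unseparated_iff_of_le hkp).2 fun u v huv h1 h2 => ?_
      by_cases hup : σ.part u = σ.part p
      · have := hz v (huv.symm.trans hup)
        omega
      · by_contra hv
        have hup' : u ≠ p := fun e => hup (by rw [e])
        have huq' : u ≠ q := fun e => hup (by rw [e, hpart])
        have hv' : v < q ∨ p < v := by
          have hvp : v ≠ p := fun e => hup (by rw [huv, e])
          have hvq : v ≠ q := fun e => hup (by rw [huv, e, hpart])
          omega
        have hqu : q < u := by omega
        have hup2 : u < p := by omega
        rcases hv' with hv' | hv'
        · exact hup (huv.trans ((hσ v q u p hv' hqu hup2 huv.symm hpart).trans hpart))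
        · exact hup ((hσ q u p v hqu hup2 hv' hpart huv).symm.trans hpart)

theorem unseparated_kreweras_step {σ : SetPartition n} (hσ : IsNonCrossing σ) (k : Fin n) :
    Unseparated σ k (((partitionPerm σ)⁻¹ * finRotate n) k) :=
  unseparated_of_partitionPerm_eq hσ (by simp)

/-- Induction on the distance l - k. The element p with P_σ p = k + 1 shares a block with k + 1 ∈
(k, l], hence lies in (k, l] itself; it follows k in its cycle and is closer to l. -/
theorem sameCycle_of_unseparated {σ : SetPartition n} :
    ∀ (m : ℕ) (_ : IsNonCrossing σ) (k l : Fin n), k ≤ l → (l : ℕ) - k = m → Unseparated σ k l →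
      ((partitionPerm σ)⁻¹ * finRotate n).SameCycle k l := by
  intro m
  induction m using Nat.strong_induction_on with
  | _ m ih =>
    intro hσ k l hkl hm h
    rcases hkl.eq_or_lt with rfl | hlt
    · exact Equiv.Perm.SameCycle.refl _ _
    have hstep := unseparated_kreweras_step hσ k
    set p := ((partitionPerm σ)⁻¹ * finRotate n) k with hp
    have hPp : partitionPerm σ p = finRotate n k := by simp [hp]
    have hval := val_finRotate k
    have hpart := part_partitionPerm σ p
    rw [hPp] at hpart
    have hl := l.2
    rw [if_neg (by omega)] at hval
    have hmem := (unseparated_iff_of_le hkl).1 h (finRotate n k) p hpart (by omega) (by omega)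
    have hpl := ih (l - p) (by omega) hσ p l hmem.2 rfl (hstep.symm.trans h)
    have hkp : ((partitionPerm σ)⁻¹ * finRotate n).SameCycle k p := ⟨1, by simp [hp]⟩
    exact hkp.trans hpl

theorem kreweras_part_eq_iff {σ : SetPartition n} (hσ : IsNonCrossing σ) {k l : Fin n} :
    (kreweras σ).part k = (kreweras σ).part l ↔ Unseparated σ k l := by
  rw [kreweras, cyclePartition_part_eq_iff]
  constructor
  · intro h
    obtain ⟨i, -, rfl⟩ := h.exists_pow_eq'
    induction i with
    | zero => exact Unseparated.refl σ k
    | succ i ih =>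
      rw [pow_succ', Equiv.Perm.mul_apply]
      exact (ih ⟨i, by simp⟩).trans (unseparated_kreweras_step hσ _)
  · intro h
    rcases le_total k l with hkl | hkl
    · exact sameCycle_of_unseparated _ hσ k l hkl rfl h
    · exact (sameCycle_of_unseparated _ hσ l k hkl rfl h.symm).symm

/-- A block of σ meeting (i, j] stays inside (i, k]; it cannot also meet (j, k], since (j, l] is a
union of blocks. -/
theorem isNonCrossing_kreweras {σ : SetPartition n} (hσ : IsNonCrossing σ) :
    IsNonCrossing (kreweras σ) := by
  intro i j k l hij hjk hkl hik hjl
  rw [kreweras_part_eq_iff hσ] at hik hjl ⊢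
  rw [unseparated_iff_of_le (by omega)] at hik hjl ⊢
  intro u v huv h1 h2
  have hv := hik u v huv h1 (by omega)
  refine ⟨hv.1, ?_⟩
  by_contra hvj
  have := hjl v u huv.symm (by omega) (by omega)
  omega

/-- Two elements lie in the same block of `σ` if no interval that is a union of blocks separates
them. -/
theorem part_eq_of_forall_unseparated {σ : SetPartition n} (hσ : IsNonCrossing σ) {i j : Fin n}
    (hij : i < j)
    (h : ∀ k l, Unseparated σ k l → ((i ≤ k ↔ i ≤ l) ↔ (j ≤ k ↔ j ≤ l))) :
    σ.part i = σ.part j := by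
  by_contra hne
  -- Let p be the last element before j of the block of i, q its cyclic successor, and k the
  -- position before q. Then k and p are unseparated, while the interval between them contains
  -- exactly one of i and j.
  have hne' : ((σ.part i).filter (· < j)).Nonempty :=
    ⟨i, Finset.mem_filter.2 ⟨σ.self_mem_part i, hij⟩⟩
  set p := ((σ.part i).filter (· < j)).max' hne' with hp
  have hpm := Finset.max'_mem _ hne'
  rw [← hp, Finset.mem_filter, σ.mem_part_iff] at hpm
  have hip : i ≤ p := Finset.le_max' _ _ (Finset.mem_filter.2 ⟨σ.self_mem_part i, hij⟩)
  have hmax : ∀ z, σ.part z = σ.part i → z < j → z ≤ p := fun z hz hzj =>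
    Finset.le_max' _ _ (Finset.mem_filter.2 ⟨σ.mem_part_iff.2 hz, hzj⟩)
  have hpart := part_partitionPerm σ p
  have hnext := partitionPerm_next σ p
  set q := partitionPerm σ p with hq
  have hk : partitionPerm σ p = finRotate n ((finRotate n).symm q) :=
    ((finRotate n).apply_symm_apply q).symm
  have hval := val_finRotate ((finRotate n).symm q)
  have hun := unseparated_of_partitionPerm_eq hσ hk
  rw [Equiv.apply_symm_apply] at hval
  generalize (finRotate n).symm q = k at *
  have hh := h k p hun
  have hjq : j ≠ q := fun e => hne (by rw [e, hpart, hpm.1])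
  have hj := j.2
  rcases hnext with ⟨hpq, hz⟩ | ⟨hpq, hz⟩
  · have hqj : ¬ q < j := fun hlt => absurd (hmax q (hpart.trans hpm.1) hlt) (by omega)
    have hjk : j ≤ k := by split_ifs at hval <;> omega
    have : i ≤ k := by omega
    have : ¬ j ≤ p := by omega
    tauto
  · have hzi := hz i hpm.1.symm
    have : ¬ j ≤ p := by omega
    split_ifs at hval with hkn
    · have : j ≤ k := by omega
      have : i ≤ k := by omega
      tauto
    · have : ¬ i ≤ k := by omega
      have : ¬ j ≤ k := by omega
      tauto

theorem part_eq_iff_forall_unseparated {σ : SetPartition n} (hσ : IsNonCrossing σ) {i j : Fin n}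
    (hij : i < j) : σ.part i = σ.part j ↔
      ∀ k l, Unseparated σ k l → ((i ≤ k ↔ i ≤ l) ↔ (j ≤ k ↔ j ≤ l)) :=
  ⟨fun h _ _ hkl => hkl i j h, part_eq_of_forall_unseparated hσ hij⟩

/-- The blocks of Kr(σ) determine the unseparated pairs, and these determine σ. -/
theorem kreweras_injOn : Set.InjOn (kreweras (n := n)) (NC n) := by
  intro σ hσ π hπ h
  have hσ' := mem_NC.1 hσ
  have hπ' := mem_NC.1 hπ
  have hun : ∀ k l, Unseparated σ k l ↔ Unseparated π k l := fun k l => by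
    rw [← kreweras_part_eq_iff hσ', ← kreweras_part_eq_iff hπ', h]
  have key : ∀ x y, x < y → (σ.part x = σ.part y ↔ π.part x = π.part y) := fun x y hxy => by
    rw [part_eq_iff_forall_unseparated hσ' hxy, part_eq_iff_forall_unseparated hπ' hxy]
    simp only [hun]
  refine SetPartition.ext_part fun x y => ?_
  rcases lt_trichotomy x y with hxy | rfl | hxy
  · exact key x y hxy
  · simp
  · rw [eq_comm, key y x hxy, eq_comm]

theorem kreweras_mem_NC {σ : SetPartition n} (hσ : σ ∈ NC n) : kreweras σ ∈ NC n :=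
  mem_NC.2 (isNonCrossing_kreweras (mem_NC.1 hσ))

theorem image_kreweras_NC : (NC n).image kreweras = NC n :=
  Finset.eq_of_subset_of_card_le
    (Finset.image_subset_iff.2 fun _ hσ => kreweras_mem_NC hσ)
    (Finset.card_image_of_injOn kreweras_injOn).ge

/-! ### Counting the blocks of σ and Kr(σ) -/

theorem card_parts_eq_card_filter_min (σ : SetPartition n) :
    σ.parts.card = (Finset.univ.filter fun x => ∀ z, σ.part z = σ.part x → x ≤ z).card := by
  symm
  refine Finset.card_nbij (fun x => σ.part x) (fun x _ => σ.part_mem_parts x) ?_ ?_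
  · intro x hx y hy hxy
    simp only [Finset.coe_filter, Finset.mem_univ, true_and, Set.mem_ofPred_eq] at hx hy
    exact le_antisymm (hx y hxy.symm) (hy x hxy)
  · intro B hB
    have hne := σ.nonempty_of_mem_parts hB
    have hmem := B.min'_mem hne
    refine ⟨B.min' hne, ?_, σ.part_eq_of_mem hB hmem⟩
    simp only [Finset.coe_filter, Finset.mem_univ, true_and, Set.mem_ofPred_eq]
    exact fun z hz => B.min'_le z (σ.mem_of_part_eq hB hmem hz.symm)

theorem card_parts_eq_card_filter_max (σ : SetPartition n) :
    σ.parts.card = (Finset.univ.filter fun x => ∀ z, σ.part z = σ.part x → z ≤ x).card := by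
  symm
  refine Finset.card_nbij (fun x => σ.part x) (fun x _ => σ.part_mem_parts x) ?_ ?_
  · intro x hx y hy hxy
    simp only [Finset.coe_filter, Finset.mem_univ, true_and, Set.mem_ofPred_eq] at hx hy
    exact le_antisymm (hy x hxy) (hx y hxy.symm)
  · intro B hB
    have hne := σ.nonempty_of_mem_parts hB
    have hmem := B.max'_mem hne
    refine ⟨B.max' hne, ?_, σ.part_eq_of_mem hB hmem⟩
    simp only [Finset.coe_filter, Finset.mem_univ, true_and, Set.mem_ofPred_eq]
    exact fun z hz => B.le_max' z (σ.mem_of_part_eq hB hmem hz.symm)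

theorem card_filter_univ_last {m : ℕ} (p : Fin (m + 1) → Prop) [DecidablePred p] :
    (Finset.univ.filter p).card = (if p (Fin.last m) then 1 else 0) +
      (Finset.univ.filter fun k : Fin m => p k.castSucc).card := by
  rw [Finset.card_filter, Fin.sum_univ_castSucc, ← Finset.card_filter, add_comm]

/-- Count the blocks of σ by their minima and those of Kr(σ) by their maxima. For k below the last
position, k + 1 is a minimum for σ exactly when k is not a maximum for Kr(σ); besides these, the
first position is always a minimum and the last always a maximum. -/
theorem card_parts_add_card_kreweras_parts {m : ℕ} {σ : SetPartition (m + 1)}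
    (hσ : IsNonCrossing σ) : σ.parts.card + (kreweras σ).parts.card = m + 2 := by
  have h1 : σ.parts.card = 1 + (Finset.univ.filter fun k : Fin m =>
      ¬ ∀ z, (kreweras σ).part z = (kreweras σ).part k.castSucc → z ≤ k.castSucc).card := by
    rw [card_parts_eq_card_filter_min, Fin.card_filter_univ_succ,
      if_pos (fun z _ => Fin.zero_le z), add_comm]
    congr 2
    ext k
    simp only [Finset.mem_filter, Finset.mem_univ, true_and, not_forall]
    constructor
    · intro hk
      have hP := part_partitionPerm σ ((partitionPerm σ).symm k.succ)
      have hn := partitionPerm_next σ ((partitionPerm σ).symm k.succ)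
      have hrot : k.succ = finRotate (m + 1) k.castSucc :=
        (finRotate_castSucc k).symm
      have hun := unseparated_of_partitionPerm_eq hσ (k := k.castSucc)
        (p := (partitionPerm σ).symm k.succ) (by simp [← hrot])
      rw [Equiv.apply_symm_apply] at hP hn
      refine ⟨(partitionPerm σ).symm k.succ,
        ((kreweras_part_eq_iff hσ).2 hun).symm, not_le.2 ?_⟩
      have := hk _ hP.symm
      rw [Fin.lt_def]
      rw [Fin.le_def] at this
      simp at this ⊢
      omega
    · rintro ⟨l, hl, hkl⟩ z hz
      have hlt := not_le.1 hkl
      have := (unseparated_iff_of_le hlt.le).1 ((kreweras_part_eq_iff hσ).1 hl.symm) k.succ z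
        hz.symm Fin.castSucc_lt_succ (Fin.castSucc_lt_iff_succ_le.1 hlt)
      exact Fin.castSucc_lt_iff_succ_le.1 this.1
  have h2 : (kreweras σ).parts.card = 1 + (Finset.univ.filter fun k : Fin m =>
      ∀ z, (kreweras σ).part z = (kreweras σ).part k.castSucc → z ≤ k.castSucc).card := by
    rw [card_parts_eq_card_filter_max, card_filter_univ_last,
      if_pos (fun z _ => Fin.le_last z)]
  have h3 := Finset.card_filter_add_card_filter_not (s := (Finset.univ : Finset (Fin m)))
    (fun k : Fin m =>
      ∀ z, (kreweras σ).part z = (kreweras σ).part k.castSucc → z ≤ k.castSucc)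
  rw [Finset.card_univ, Fintype.card_fin] at h3
  omega

end

end FreeProb

namespace FreeProb

noncomputable section

/-! ### Refinements and the relative Kreweras complement -/

namespace SetPartition

variable {n : ℕ}

/-- `σ` refines `π`. -/
def Finer (σ π : SetPartition n) : Prop :=
  ∀ x y, σ.part x = σ.part y → π.part x = π.part y

/-- The restriction of a partition to a set `B`, transported to `{1, …, |B|}`. -/
def pull (σ : SetPartition n) (B : Finset (Fin n)) : SetPartition B.card :=
  ofRel (Setoid.ker fun t => σ.part (B.orderEmbOfFin rfl t))

theorem pull_part_eq_iff (σ : SetPartition n) (B : Finset (Fin n)) {s t : Fin B.card} :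
    (σ.pull B).part s = (σ.pull B).part t ↔
      σ.part (B.orderEmbOfFin rfl s) = σ.part (B.orderEmbOfFin rfl t) := by
  rw [pull, ofRel_part_eq_iff]
  rfl

/-- Partitions of the blocks of `π`, put together to a refinement of `π`. -/
def glue (π : SetPartition n) (p : ∀ B : π.parts, SetPartition B.1.card) : SetPartition n :=
  ofRel
    { r := fun x y => ∃ (B : π.parts) (s t : Fin B.1.card),
        B.1.orderEmbOfFin rfl s = x ∧ B.1.orderEmbOfFin rfl t = y ∧ (p B).part s = (p B).part t
      iseqv :=
        { refl := fun x => by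
            obtain ⟨t, ht⟩ := exists_orderEmbOfFin_eq (π.self_mem_part x)
            exact ⟨⟨π.part x, π.part_mem_parts x⟩, t, t, ht, ht, rfl⟩
          symm := by
            rintro x y ⟨B, s, t, hs, ht, h⟩
            exact ⟨B, t, s, ht, hs, h.symm⟩
          trans := by
            rintro x y z ⟨B, s, t, hs, ht, h⟩ ⟨C, u, v, hu, hv, h'⟩
            have hBC : B = C := Subtype.ext (π.eq_of_mem_parts B.2 C.2 (a := y)
              (ht ▸ Finset.orderEmbOfFin_mem _ _ _) (hu ▸ Finset.orderEmbOfFin_mem _ _ _))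
            subst hBC
            have htu : t = u := (B.1.orderEmbOfFin rfl).injective (ht.trans hu.symm)
            subst htu
            exact ⟨B, s, v, hs, hv, h.trans h'⟩ } }

theorem glue_part_eq_iff (π : SetPartition n) (p : ∀ B : π.parts, SetPartition B.1.card)
    (B : π.parts) {s t : Fin B.1.card} :
    (glue π p).part (B.1.orderEmbOfFin rfl s) = (glue π p).part (B.1.orderEmbOfFin rfl t) ↔
      (p B).part s = (p B).part t := by
  rw [glue, ofRel_part_eq_iff]
  constructor
  · rintro ⟨C, u, v, hu, hv, h⟩
    have hBC : B = C := Subtype.ext (π.eq_of_mem_parts B.2 C.2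
      (Finset.orderEmbOfFin_mem _ rfl s) (hu ▸ Finset.orderEmbOfFin_mem _ _ _))
    subst hBC
    rwa [(B.1.orderEmbOfFin rfl).injective hu, (B.1.orderEmbOfFin rfl).injective hv] at h
  · exact fun h => ⟨B, s, t, rfl, rfl, h⟩

theorem glue_finer (π : SetPartition n) (p : ∀ B : π.parts, SetPartition B.1.card) :
    Finer (glue π p) π := by
  intro x y h
  rw [glue, ofRel_part_eq_iff] at h
  obtain ⟨B, s, t, rfl, rfl, -⟩ := h
  exact π.part_eq_part_of_mem B.2 (Finset.orderEmbOfFin_mem _ _ _)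
    (Finset.orderEmbOfFin_mem _ _ _)

theorem exists_eq_of_part_eq (π : SetPartition n) {x y : Fin n} (h : π.part x = π.part y) :
    ∃ (B : π.parts) (s t : Fin B.1.card),
      B.1.orderEmbOfFin rfl s = x ∧ B.1.orderEmbOfFin rfl t = y := by
  obtain ⟨s, hs⟩ := exists_orderEmbOfFin_eq (π.self_mem_part x)
  obtain ⟨t, ht⟩ := exists_orderEmbOfFin_eq (π.mem_part_iff.2 h.symm)
  exact ⟨⟨π.part x, π.part_mem_parts x⟩, s, t, hs, ht⟩

theorem pull_glue (π : SetPartition n) (p : ∀ B : π.parts, SetPartition B.1.card) (B : π.parts) :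
    (glue π p).pull B.1 = p B :=
  ext_part fun s t => by rw [pull_part_eq_iff, glue_part_eq_iff]

theorem ext_of_finer {π σ τ : SetPartition n} (hσ : Finer σ π) (hτ : Finer τ π)
    (h : ∀ B : π.parts, σ.pull B.1 = τ.pull B.1) : σ = τ := by
  have key : ∀ x y, π.part x = π.part y → (σ.part x = σ.part y ↔ τ.part x = τ.part y) := by
    intro x y hxy
    obtain ⟨B, s, t, rfl, rfl⟩ := π.exists_eq_of_part_eq hxy
    rw [← pull_part_eq_iff, h B, pull_part_eq_iff]
  exact ext_part fun x y =>
    ⟨fun hxy => (key x y (hσ x y hxy)).1 hxy, fun hxy => (key x y (hτ x y hxy)).2 hxy⟩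

theorem glue_pull {π σ : SetPartition n} (hσ : Finer σ π) :
    glue π (fun B => σ.pull B.1) = σ :=
  ext_of_finer (glue_finer _ _) hσ fun B => pull_glue _ _ B

theorem isNonCrossing_pull {σ : SetPartition n} (hσ : IsNonCrossing σ) (B : Finset (Fin n)) :
    IsNonCrossing (σ.pull B) := by
  intro i j k l hij hjk hkl hik hjl
  rw [pull_part_eq_iff] at hik hjl ⊢
  exact hσ _ _ _ _ ((OrderEmbedding.lt_iff_lt _).2 hij) ((OrderEmbedding.lt_iff_lt _).2 hjk)
    ((OrderEmbedding.lt_iff_lt _).2 hkl) hik hjl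

/-- Four positions forming a crossing of σ lie in a single block of π, because π has no crossing,
and so the question is decided inside that block. -/
theorem isNonCrossing_of_finer {π σ : SetPartition n} (hπ : IsNonCrossing π) (hσ : Finer σ π)
    (h : ∀ B : π.parts, IsNonCrossing (σ.pull B.1)) : IsNonCrossing σ := by
  intro i j k l hij hjk hkl hik hjl
  have hπik := hσ _ _ hik
  have hπij := hπ i j k l hij hjk hkl hπik (hσ _ _ hjl)
  have hmem : ∀ x, π.part i = π.part x → ∃ t, (π.part i).orderEmbOfFin rfl t = x := fun x hx =>
    exists_orderEmbOfFin_eq (π.mem_part_iff.2 hx.symm)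
  obtain ⟨i', hi⟩ := hmem i rfl
  obtain ⟨j', rfl⟩ := hmem j hπij
  obtain ⟨k', rfl⟩ := hmem k hπik
  obtain ⟨l', rfl⟩ := hmem l (hπij.trans (hσ _ _ hjl))
  have hB := h ⟨π.part i, π.part_mem_parts i⟩ i' j' k' l'
  rw [pull_part_eq_iff, pull_part_eq_iff, pull_part_eq_iff] at hB
  simp only [hi] at hB
  refine hB ?_ ((OrderEmbedding.lt_iff_lt _).1 hjk) ((OrderEmbedding.lt_iff_lt _).1 hkl) hik hjl
  rw [← OrderEmbedding.lt_iff_lt ((π.part i).orderEmbOfFin rfl), hi]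
  exact hij

end SetPartition

/-! ### The relative Kreweras complement -/

open SetPartition

variable {n : ℕ}

/-- The blockwise Kreweras complement of `σ` inside of `π`. -/
def relKreweras (π σ : SetPartition n) : SetPartition n :=
  glue π fun B => kreweras (σ.pull B.1)

theorem pull_relKreweras (π σ : SetPartition n) (B : π.parts) :
    (relKreweras π σ).pull B.1 = kreweras (σ.pull B.1) :=
  pull_glue _ _ _

theorem relKreweras_finer (π σ : SetPartition n) : Finer (relKreweras π σ) π :=
  glue_finer _ _

theorem isNonCrossing_relKreweras {π σ : SetPartition n} (hπ : IsNonCrossing π)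
    (hσ : IsNonCrossing σ) : IsNonCrossing (relKreweras π σ) :=
  isNonCrossing_of_finer hπ (relKreweras_finer π σ) fun B => by
    rw [pull_relKreweras]
    exact isNonCrossing_kreweras (isNonCrossing_pull hσ B.1)

/-- The enumeration of a block preserves order, so the interval criterion transfers to the block,
tested only on its own elements. This removes `pull` and `glue` from later arguments. -/
theorem relKreweras_part_eq_iff {π σ : SetPartition n} (hσ : IsNonCrossing σ) {x y : Fin n} :
    (relKreweras π σ).part x = (relKreweras π σ).part y ↔
      π.part x = π.part y ∧ ∀ u v, π.part u = π.part x → π.part v = π.part x →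
        σ.part u = σ.part v → ((u ≤ x ↔ u ≤ y) ↔ (v ≤ x ↔ v ≤ y)) := by
  by_cases hxy : π.part x = π.part y
  swap
  · exact ⟨fun h => absurd (relKreweras_finer π σ x y h) hxy, fun h => absurd h.1 hxy⟩
  obtain ⟨B, s, t, rfl, rfl⟩ := π.exists_eq_of_part_eq hxy
  have hs := B.1.orderEmbOfFin_mem rfl s
  rw [relKreweras, glue_part_eq_iff, kreweras_part_eq_iff (isNonCrossing_pull hσ B.1)]
  constructor
  · refine fun h => ⟨hxy, fun u v hu hv huv => ?_⟩
    obtain ⟨u', rfl⟩ := exists_orderEmbOfFin_eq (π.mem_of_part_eq B.2 hs hu.symm)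
    obtain ⟨v', rfl⟩ := exists_orderEmbOfFin_eq (π.mem_of_part_eq B.2 hs hv.symm)
    simpa only [OrderEmbedding.le_iff_le] using h u' v' ((pull_part_eq_iff _ _).2 huv)
  · rintro ⟨-, h⟩ u v huv
    have := h _ _ (π.part_eq_part_of_mem B.2 (B.1.orderEmbOfFin_mem rfl u) hs)
      (π.part_eq_part_of_mem B.2 (B.1.orderEmbOfFin_mem rfl v) hs) ((pull_part_eq_iff _ _).1 huv)
    simpa only [OrderEmbedding.le_iff_le] using this

/-- A block of σ inside the π-block of x and y is covered by the blockwise criterion; one in another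
π-block that was cut by (x, y] would make π crossing. -/
theorem relKreweras_finer_kreweras {π σ : SetPartition n} (hπ : IsNonCrossing π)
    (hσ : IsNonCrossing σ) (hσπ : Finer σ π) : Finer (relKreweras π σ) (kreweras σ) := by
  have key : ∀ x y, x ≤ y → (relKreweras π σ).part x = (relKreweras π σ).part y →
      Unseparated σ x y := by
    intro x y hxy h
    rw [relKreweras_part_eq_iff hσ] at h
    refine (unseparated_iff_of_le hxy).2 fun u v huv hxu huy => ?_
    have huv' := hσπ u v huv
    by_cases hu : π.part u = π.part x
    · have := h.2 u v hu (huv'.symm.trans hu) huv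
      have hux : ¬ u ≤ x := not_le.2 hxu
      by_contra hcon
      have : v ≤ x ↔ v ≤ y := by
        constructor <;> intro <;> by_contra <;> apply hcon <;> omega
      tauto
    · by_contra hv
      have huy' : u ≠ y := fun e => hu (by rw [e, h.1])
      have hvx : v ≠ x := fun e => hu (by rw [huv', e])
      rcases lt_or_ge v x with hvx' | hvx'
      · exact hu (huv'.trans (hπ v x u y hvx' hxu (by omega) huv'.symm h.1))
      · exact hu (hπ x u y v hxu (by omega) (by omega) h.1 huv').symm
  intro x y h
  rw [kreweras_part_eq_iff hσ]
  rcases le_total x y with hxy | hxy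
  · exact key x y hxy h
  · exact (key y x hxy h.symm).symm

/-- If (k, l] cut a block of π, take its last element u inside the interval and the element v
outside that precedes the inner part cyclically. Within this block, u and v bound the same interval
as k and l up to complement, so they share a block of Kr_π(σ), which (k, l] then cuts, against `h`.
-/
theorem unseparated_of_relKreweras {π σ : SetPartition n} (hπ : IsNonCrossing π)
    (hσ : IsNonCrossing σ) (hσπ : Finer σ π) {k l : Fin n} (hkl : k ≤ l)
    (hun : Unseparated σ k l)
    (h : ∀ u v, Unseparated σ u k → (relKreweras π σ).part u = (relKreweras π σ).part v →
      ((u ≤ k ↔ u ≤ l) ↔ (v ≤ k ↔ v ≤ l))) : Unseparated π k l := by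
  rw [unseparated_iff_of_le hkl]
  intro x y hxy hkx hxl
  by_contra hy
  have hun' := (unseparated_iff_of_le hkl).1 hun
  -- the last element `u` of the block inside of the interval
  have hne : ((π.part x).filter (· ≤ l)).Nonempty :=
    ⟨x, Finset.mem_filter.2 ⟨π.self_mem_part x, hxl⟩⟩
  obtain ⟨u, hu⟩ : ∃ u, u = ((π.part x).filter (· ≤ l)).max' hne := ⟨_, rfl⟩
  have hum := Finset.max'_mem _ hne
  rw [← hu, Finset.mem_filter, π.mem_part_iff] at hum
  have humax : ∀ z, π.part z = π.part x → z ≤ l → z ≤ u := fun z hz hzl => by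
    rw [hu]
    exact Finset.le_max' _ _ (Finset.mem_filter.2 ⟨π.mem_part_iff.2 hz, hzl⟩)
  have hxu := humax x rfl hxl
  -- A block of σ inside (k, l] extending across u lies in another π-block, and would cross the pair
  -- u, y, as y is outside the interval.
  have huk : Unseparated σ u k := by
    refine Unseparated.symm ((unseparated_iff_of_le (by omega)).2 fun a b hab hka hau => ?_)
    have hb := hun' a b hab hka (by omega)
    refine ⟨hb.1, ?_⟩
    by_contra hbu
    have hab' := hσπ a b hab
    have hbx : π.part b ≠ π.part x := fun e => absurd (humax b e hb.2) hbu
    have hau' : a ≠ u := fun e => hbx (by rw [← hab', e, hum.1])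
    rcases lt_or_ge k y with hky | hky
    · exact hbx (hab'.symm.trans
        ((hπ a u b y (by omega) (by omega) (by omega) hab' (hum.1.trans hxy)).trans hum.1))
    · exact hbx (hab'.symm.trans ((hπ y a u b (by omega) (by omega) (by omega)
        (hxy.symm.trans hum.1.symm) hab').symm.trans hxy.symm))
  -- the element `v` of the block outside of the interval that cyclically precedes it
  obtain ⟨v, hvx, hv, hrel⟩ : ∃ v, π.part v = π.part x ∧ (v ≤ k ∨ l < v) ∧
      ((∀ a, π.part a = π.part x → ((a ≤ u ↔ a ≤ v) ↔ (a ≤ k ↔ a ≤ l))) ∨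
        ∀ a, π.part a = π.part x → ((a ≤ u ↔ a ≤ v) ↔ ¬ (a ≤ k ↔ a ≤ l))) := by
    by_cases hex : ((π.part x).filter (· ≤ k)).Nonempty
    · have hm := Finset.max'_mem _ hex
      rw [Finset.mem_filter, π.mem_part_iff] at hm
      refine ⟨_, hm.1, Or.inl hm.2, Or.inl fun a ha => ?_⟩
      have h1 : a ≤ k → a ≤ ((π.part x).filter (· ≤ k)).max' hex := fun hak =>
        Finset.le_max' _ _ (Finset.mem_filter.2 ⟨π.mem_part_iff.2 ha, hak⟩)
      have h2 := humax a ha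
      constructor <;> intro h' <;> constructor <;> intro h'' <;> omega
    -- No element of the block is at most k, so the predecessor wraps around to the maximum, which
    -- exceeds l because y does. Inside the block the interval is then replaced by its complement.
    · have hxne : (π.part x).Nonempty := ⟨x, π.self_mem_part x⟩
      have hm := Finset.max'_mem _ hxne
      have hmax : ∀ a, π.part a = π.part x → a ≤ (π.part x).max' hxne := fun a ha =>
        Finset.le_max' _ _ (π.mem_part_iff.2 ha)
      have hk : ∀ a, π.part a = π.part x → k < a := fun a ha => by
        by_contra hak
        exact hex ⟨a, Finset.mem_filter.2 ⟨π.mem_part_iff.2 ha, not_lt.1 hak⟩⟩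
      rw [π.mem_part_iff] at hm
      refine ⟨_, hm, Or.inr ?_, Or.inr fun a ha => ?_⟩
      · have := hmax y hxy.symm
        have := hk y hxy.symm
        omega
      · have h1 := hmax a ha
        have h2 := humax a ha
        have h3 : ¬ a ≤ k := not_le.2 (hk a ha)
        have h4 : a ≤ u ↔ a ≤ l := by constructor <;> intro <;> omega
        tauto
  have huv : (relKreweras π σ).part u = (relKreweras π σ).part v := by
    rw [relKreweras_part_eq_iff hσ]
    refine ⟨hum.1.trans hvx.symm, fun a b ha hb hab => ?_⟩
    have hab' := hun a b hab
    rcases hrel with hrel | hrel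
    · rwa [hrel a (ha.trans hum.1), hrel b (hb.trans hum.1)]
    · rwa [hrel a (ha.trans hum.1), hrel b (hb.trans hum.1), not_iff_not]
  have := h u v huk huv
  have : ¬ u ≤ k := by omega
  have : v ≤ k ↔ v ≤ l := by
    constructor <;> intro <;> omega
  tauto

/-- In terms of permutations, Kr_π(σ) is P_σ⁻¹P_π and Kr(σ) is P_σ⁻¹γ, whose quotient is P_π⁻¹γ. The
proof compares interval criteria; one direction is immediate, as σ and Kr_π(σ) both refine π. -/
theorem relKreweras_kreweras_relKreweras {π σ : SetPartition n} (hπ : IsNonCrossing π)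
    (hσ : IsNonCrossing σ) (hσπ : Finer σ π) :
    relKreweras (kreweras σ) (relKreweras π σ) = kreweras π := by
  refine ext_part fun k l => ?_
  rw [relKreweras_part_eq_iff (isNonCrossing_relKreweras hπ hσ), kreweras_part_eq_iff hπ]
  constructor
  · rintro ⟨hkl, h⟩
    have hun := (kreweras_part_eq_iff hσ).1 hkl
    have hfin := relKreweras_finer_kreweras hπ hσ hσπ
    rcases le_total k l with hle | hle
    · exact unseparated_of_relKreweras hπ hσ hσπ hle hun fun u v hu huv => by
        have hu' := (kreweras_part_eq_iff hσ).2 hu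
        exact h u v hu' ((hfin u v huv).symm.trans hu') huv
    · refine (unseparated_of_relKreweras hπ hσ hσπ hle hun.symm fun u v hu huv => ?_).symm
      have hu' := ((kreweras_part_eq_iff hσ).2 hu).trans hkl.symm
      have := h u v hu' ((hfin u v huv).symm.trans hu') huv
      tauto
  · intro h
    exact ⟨(kreweras_part_eq_iff hσ).2 fun u v huv => h u v (hσπ u v huv),
      fun u v _ _ huv => h u v (relKreweras_finer π σ u v huv)⟩

/-! ### Sums over non-crossing refinements -/

open Classical in
/-- The non-crossing refinements of `π`. -/
def NCBelow (π : SetPartition n) : Finset (SetPartition n) := (NC n).filter fun σ => Finer σ π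

theorem mem_NCBelow {π σ : SetPartition n} : σ ∈ NCBelow π ↔ IsNonCrossing σ ∧ Finer σ π := by
  classical
  rw [NCBelow, Finset.mem_filter, mem_NC]

/-- Both sides are the sum over the triples `(σ, ρ, τ)` with `P_σ P_ρ P_τ = (1 2 ⋯ n)` in the
non-crossing sense. -/
theorem sum_NC_sum_NCBelow {M : Type*} [AddCommMonoid M]
    (F : SetPartition n → SetPartition n → SetPartition n → M) :
    ∑ π ∈ NC n, ∑ σ ∈ NCBelow π, F σ (relKreweras π σ) (kreweras π) =
      ∑ σ ∈ NC n, ∑ ρ ∈ NCBelow (kreweras σ), F σ ρ (relKreweras (kreweras σ) ρ) := by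
  rw [Finset.sum_sigma', Finset.sum_sigma']
  -- The pair (π, σ) goes to (σ, Kr_π(σ)). It is recovered from its image, which determines Kr(π)
  -- and hence π.
  have hmaps : Set.MapsTo
      (fun x : (_ : SetPartition n) × SetPartition n =>
        (⟨x.2, relKreweras x.1 x.2⟩ : (_ : SetPartition n) × SetPartition n))
      ((NC n).sigma NCBelow) ((NC n).sigma fun σ => NCBelow (kreweras σ)) := by
    rintro ⟨π, σ⟩ h
    simp only [Finset.coe_sigma, Set.mem_sigma_iff, Finset.mem_coe, mem_NC, mem_NCBelow] at h ⊢
    exact ⟨h.2.1, isNonCrossing_relKreweras h.1 h.2.1, relKreweras_finer_kreweras h.1 h.2.1 h.2.2⟩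
  have hinj : Set.InjOn
      (fun x : (_ : SetPartition n) × SetPartition n =>
        (⟨x.2, relKreweras x.1 x.2⟩ : (_ : SetPartition n) × SetPartition n))
      ((NC n).sigma NCBelow) := by
    rintro ⟨π, σ⟩ h ⟨π', σ'⟩ h' heq
    simp only [Finset.coe_sigma, Set.mem_sigma_iff, Finset.mem_coe, mem_NC, mem_NCBelow] at h h'
    simp only [Sigma.mk.injEq, heq_eq_eq] at heq
    obtain ⟨rfl, hrel⟩ := heq
    have := relKreweras_kreweras_relKreweras h.1 h.2.1 h.2.2
    rw [hrel, relKreweras_kreweras_relKreweras h'.1 h'.2.1 h'.2.2] at this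
    rw [kreweras_injOn (mem_NC.2 h'.1) (mem_NC.2 h.1) this]
  -- Since Kr permutes NC(n), both index sets have the same size; injectivity then suffices and no
  -- inverse is needed.
  have hcard : ((NC n).sigma fun σ => NCBelow (kreweras σ)).card ≤
      ((NC n).sigma NCBelow).card := by
    rw [Finset.card_sigma, Finset.card_sigma]
    conv_rhs => rw [← image_kreweras_NC]
    rw [Finset.sum_image fun x hx y hy => kreweras_injOn hx hy]
  refine Finset.sum_nbij _ hmaps hinj (Finset.surjOn_of_injOn_of_card_le _ hmaps hinj hcard) ?_
  rintro ⟨π, σ⟩ h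
  simp only [Finset.mem_sigma, mem_NC, mem_NCBelow] at h
  simp only [relKreweras_kreweras_relKreweras h.1 h.2.1 h.2.2]

/-- A product of sums over the non-crossing partitions of the blocks of `π` is a sum over the
non-crossing refinements of `π`. -/
theorem prod_sum_NC {R : Type*} [CommSemiring R] {π : SetPartition n} (hπ : IsNonCrossing π)
    (Φ : ∀ B : Finset (Fin n), SetPartition B.card → R) :
    ∏ B ∈ π.parts, ∑ τ ∈ NC B.card, Φ B τ =
      ∑ σ ∈ NCBelow π, ∏ B ∈ π.parts, Φ B (σ.pull B) := by
  rw [← Finset.prod_coe_sort π.parts fun B => ∑ τ ∈ NC B.card, Φ B τ]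
  rw [Finset.prod_univ_sum (fun B : π.parts => NC B.1.card) fun B τ => Φ B.1 τ]
  refine Finset.sum_bij' (fun p _ => glue π p) (fun σ _ B => σ.pull B.1) ?_ ?_ ?_ ?_ ?_
  · intro p hp
    rw [Fintype.mem_piFinset] at hp
    refine mem_NCBelow.2 ⟨isNonCrossing_of_finer hπ (glue_finer π p) fun B => ?_, glue_finer π p⟩
    rw [pull_glue]
    exact mem_NC.1 (hp B)
  · intro σ hσ
    rw [Fintype.mem_piFinset]
    exact fun B => mem_NC.2 (isNonCrossing_pull (mem_NCBelow.1 hσ).1 B.1)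
  · intro p _
    funext B
    exact pull_glue π p B
  · intro σ hσ
    exact glue_pull (mem_NCBelow.1 hσ).2
  · intro p _
    rw [← Finset.prod_coe_sort π.parts fun B => Φ B ((glue π p).pull B)]
    exact Finset.prod_congr rfl fun B _ => by rw [pull_glue]

end

end FreeProb

namespace FreeProb

noncomputable section

variable {ι κ δ : Type*} {n : ℕ}

open SetPartition

/-! ### Generalized coefficients and associativity of the boxed convolution -/

theorem coeff_mkSeries (c : (n : ℕ) → (Fin n → ι) → ℂ) (hn : n ≠ 0) (w : Fin n → ι) :
    coeff (mkSeries c) w = c n w := by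
  simp [coeff, mkSeries, hn]

theorem coeff_smul (c : ℂ) (f : Theta ι) (w : Fin n → ι) : coeff (c • f) w = c * coeff f w := rfl

theorem Theta.ext_coeff {f g : Theta ι}
    (h : ∀ n (w : Fin n → ι), n ≠ 0 → coeff f w = coeff g w) : f = g := by
  refine Subtype.ext (funext fun n => funext fun w => ?_)
  by_cases hn : n = 0
  · subst hn
    exact (f.2 w).trans (g.2 w).symm
  · exact h n w hn

theorem coeff_restrictWord (f : Theta ι) (w : Fin n → ι) {B : Finset (Fin n)} {k : ℕ}
    (h : B.card = k) : coeff f (restrictWord w B) = coeff f fun t => w (B.orderEmbOfFin h t) := by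
  subst h
  rfl

theorem genCoeff_mkSeries (c : (n : ℕ) → (Fin n → ι) → ℂ) (w : Fin n → ι) (π : SetPartition n) :
    genCoeff (mkSeries c) w π = ∏ B ∈ π.parts, c B.card (restrictWord w B) :=
  Finset.prod_congr rfl fun _ hB => coeff_mkSeries c (card_pos_of_mem_parts π hB) _

theorem map_part_pull {π σ : SetPartition n} (hσ : Finer σ π) {B : Finset (Fin n)}
    (hB : B ∈ π.parts) (t : Fin B.card) :
    ((σ.pull B).part t).map (B.orderEmbOfFin rfl).toEmbedding =
      σ.part (B.orderEmbOfFin rfl t) := by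
  ext y
  rw [Finset.mem_map, mem_part_iff]
  constructor
  · rintro ⟨s, hs, rfl⟩
    exact (pull_part_eq_iff _ _).1 ((mem_part_iff _).1 hs)
  · intro hy
    obtain ⟨s, rfl⟩ := exists_orderEmbOfFin_eq
      (π.mem_of_part_eq hB (B.orderEmbOfFin_mem rfl t) (hσ _ _ hy.symm))
    exact ⟨s, (mem_part_iff _).2 ((pull_part_eq_iff _ _).2 hy), rfl⟩

/-- Multiplicativity of the generalized coefficients over the blocks of a coarser partition. -/
theorem genCoeff_eq_prod_pull (f : Theta ι) (w : Fin n → ι) {π σ : SetPartition n}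
    (hσ : Finer σ π) :
    genCoeff f w σ = ∏ B ∈ π.parts, genCoeff f (restrictWord w B) (σ.pull B) := by
  simp only [genCoeff]
  rw [Finset.prod_sigma']
  symm
  refine Finset.prod_bij (fun x _ => x.2.map (x.1.orderEmbOfFin rfl).toEmbedding) ?_ ?_ ?_ ?_
  · rintro ⟨B, V⟩ h
    obtain ⟨hB, hV⟩ := Finset.mem_sigma.1 h
    obtain ⟨t, ht⟩ := (σ.pull B).nonempty_of_mem_parts hV
    simp only at hB hV ht ⊢
    rw [← (σ.pull B).part_eq_of_mem hV ht, map_part_pull hσ hB]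
    exact σ.part_mem_parts _
  · rintro ⟨B, V⟩ h ⟨C, W⟩ h' heq
    obtain ⟨hB, hV⟩ := Finset.mem_sigma.1 h
    obtain ⟨hC, -⟩ := Finset.mem_sigma.1 h'
    obtain ⟨t, ht⟩ := (σ.pull B).nonempty_of_mem_parts hV
    simp only at hB hC heq ht
    have hmem := Finset.mem_map_of_mem (B.orderEmbOfFin rfl).toEmbedding ht
    rw [heq, Finset.mem_map] at hmem
    obtain ⟨s, -, hs⟩ := hmem
    have hBC : B = C := π.eq_of_mem_parts hB hC (B.orderEmbOfFin_mem rfl t)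
      (by
        have := C.orderEmbOfFin_mem rfl s
        rwa [show C.orderEmbOfFin rfl s = B.orderEmbOfFin rfl t from hs] at this)
    subst hBC
    rw [Finset.map_injective _ heq]
  · intro V hV
    obtain ⟨x, hx⟩ := σ.nonempty_of_mem_parts hV
    obtain ⟨t, ht⟩ := exists_orderEmbOfFin_eq (π.self_mem_part x)
    refine ⟨⟨π.part x, (σ.pull (π.part x)).part t⟩,
      Finset.mem_sigma.2 ⟨π.part_mem_parts x, part_mem_parts _ _⟩, ?_⟩
    simp only
    rw [map_part_pull hσ (π.part_mem_parts x), ht, σ.part_eq_of_mem hV hx]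
  · rintro ⟨B, V⟩ _
    simp only
    rw [coeff_restrictWord f w (Finset.card_map (s := V) (B.orderEmbOfFin rfl).toEmbedding)]
    congr 1
    funext t
    -- The composite of two increasing enumerations is the increasing enumeration of the image.
    rw [← Finset.orderEmbOfFin_unique
      (Finset.card_map (s := V) (B.orderEmbOfFin rfl).toEmbedding)
      (f := fun t => B.orderEmbOfFin rfl (V.orderEmbOfFin rfl t))
      (fun t => Finset.mem_map_of_mem _ (V.orderEmbOfFin_mem rfl t))
      ((B.orderEmbOfFin rfl).strictMono.comp (V.orderEmbOfFin rfl).strictMono)]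
    rfl

/-- The common generalization of the boxed convolution and its extension: the indeterminates of
the second series are read through `p`. -/
def conv (p : ι → δ) (f : Theta ι) (g : Theta δ) : Theta ι :=
  mkSeries fun n w =>
    ∑ π ∈ NC n, genCoeff f w π * genCoeff g (fun k => p (w k)) (kreweras π)

theorem boxConv_eq_conv (f g : Theta ι) : boxConv f g = conv id f g := rfl

theorem coeff_conv (p : ι → δ) (f : Theta ι) (g : Theta δ) (hn : n ≠ 0) (w : Fin n → ι) :
    coeff (conv p f g) w =
      ∑ π ∈ NC n, genCoeff f w π * genCoeff g (fun k => p (w k)) (kreweras π) :=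
  coeff_mkSeries _ hn w

/-- Distributing the product over the blocks of π turns choices of one partition per block into one
refinement σ of π; the blockwise complements glue to Kr_π(σ). -/
theorem genCoeff_conv (p : ι → δ) (f : Theta ι) (g : Theta δ) (w : Fin n → ι)
    {π : SetPartition n} (hπ : IsNonCrossing π) :
    genCoeff (conv p f g) w π = ∑ σ ∈ NCBelow π,
      genCoeff f w σ * genCoeff g (fun k => p (w k)) (relKreweras π σ) := by
  rw [conv, genCoeff_mkSeries, prod_sum_NC hπ fun B τ => genCoeff f (restrictWord w B) τ *
    genCoeff g (fun k => p (restrictWord w B k)) (kreweras τ)]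
  refine Finset.sum_congr rfl fun σ hσ => ?_
  rw [Finset.prod_mul_distrib, ← genCoeff_eq_prod_pull f w (mem_NCBelow.1 hσ).2,
    genCoeff_eq_prod_pull g _ (relKreweras_finer π σ)]
  congr 1
  refine Finset.prod_congr rfl fun B hB => ?_
  rw [pull_relKreweras π σ ⟨B, hB⟩]
  rfl

theorem conv_assoc (p : ι → δ) (f : Theta ι) (g h : Theta δ) :
    conv p (conv p f g) h = conv p f (conv id g h) := by
  refine Theta.ext_coeff fun n w hn => ?_
  rw [coeff_conv _ _ _ hn, coeff_conv _ _ _ hn]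
  have h1 : ∀ π ∈ NC n, genCoeff (conv p f g) w π *
      genCoeff h (fun k => p (w k)) (kreweras π) = ∑ σ ∈ NCBelow π,
        genCoeff f w σ * genCoeff g (fun k => p (w k)) (relKreweras π σ) *
          genCoeff h (fun k => p (w k)) (kreweras π) := fun π hπ => by
    rw [genCoeff_conv p f g w (mem_NC.1 hπ), Finset.sum_mul]
  have h2 : ∀ σ ∈ NC n, genCoeff f w σ *
      genCoeff (conv id g h) (fun k => p (w k)) (kreweras σ) = ∑ ρ ∈ NCBelow (kreweras σ),
        genCoeff f w σ * genCoeff g (fun k => p (w k)) ρ *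
          genCoeff h (fun k => p (w k)) (relKreweras (kreweras σ) ρ) := fun σ hσ => by
    rw [genCoeff_conv id g h _ (isNonCrossing_kreweras (mem_NC.1 hσ)), Finset.mul_sum]
    simp only [mul_assoc, id]
  rw [Finset.sum_congr rfl h1, Finset.sum_congr rfl h2]
  exact sum_NC_sum_NCBelow fun σ ρ τ => genCoeff f w σ * genCoeff g (fun k => p (w k)) ρ *
    genCoeff h (fun k => p (w k)) τ

theorem forall_card_eq_one_iff (τ : SetPartition n) :
    (∀ B ∈ τ.parts, B.card = 1) ↔ τ.parts.card = n := by
  have hsum := τ.sum_card_parts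
  rw [Finset.card_univ, Fintype.card_fin] at hsum
  have hle : ∀ B ∈ τ.parts, 1 ≤ B.card := fun B hB =>
    Nat.one_le_iff_ne_zero.2 (card_pos_of_mem_parts τ hB)
  have := Finset.sum_eq_sum_iff_of_le hle
  rw [hsum, Finset.sum_const, smul_eq_mul, mul_one] at this
  rw [this]
  exact forall₂_congr fun _ _ => eq_comm

theorem genCoeff_deltaSeries (w : Fin n → ι) (τ : SetPartition n) :
    genCoeff (deltaSeries ι) w τ = if τ.parts.card = n then 1 else 0 := by
  rw [deltaSeries, genCoeff_mkSeries, Finset.prod_ite_zero, Finset.prod_const_one]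
  simp only [forall_card_eq_one_iff]

theorem isNonCrossing_indiscrete (h : (Finset.univ : Finset (Fin n)) ≠ ⊥) :
    IsNonCrossing (Finpartition.indiscrete h) := fun i j _ _ _ _ _ _ _ =>
  part_eq_part_of_mem _ (B := Finset.univ) (by simp) (Finset.mem_univ i) (Finset.mem_univ j)

theorem genCoeff_indiscrete (f : Theta ι) (w : Fin n → ι)
    (h : (Finset.univ : Finset (Fin n)) ≠ ⊥) :
    genCoeff f w (Finpartition.indiscrete h) = coeff f w := by
  rw [genCoeff, Finpartition.indiscrete_parts, Finset.prod_singleton,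
    coeff_restrictWord f w (Finset.card_fin n),
    ← Finset.orderEmbOfFin_unique (Finset.card_fin n) (f := id) (fun _ => Finset.mem_univ _)
      strictMono_id]
  rfl

/-- The factor from Δ survives only when Kr(π) has n blocks; as |π| + |Kr(π)| = n + 1, this leaves
the one-block partition. -/
theorem conv_deltaSeries (f : Theta ι) : conv id f (deltaSeries ι) = f := by
  refine Theta.ext_coeff fun n w hn => ?_
  rw [coeff_conv _ _ _ hn]
  obtain ⟨m, rfl⟩ := Nat.exists_eq_add_one_of_ne_zero hn
  have huniv : (Finset.univ : Finset (Fin (m + 1))) ≠ ⊥ := Finset.univ_nonempty.ne_empty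
  rw [Finset.sum_eq_single (Finpartition.indiscrete huniv)]
  · have := card_parts_add_card_kreweras_parts (isNonCrossing_indiscrete huniv)
    rw [Finpartition.indiscrete_parts, Finset.card_singleton] at this
    rw [genCoeff_deltaSeries, if_pos (by omega), mul_one, genCoeff_indiscrete]
  · intro π hπ hne
    have := card_parts_add_card_kreweras_parts (mem_NC.1 hπ)
    rw [genCoeff_deltaSeries, if_neg, mul_zero]
    intro hcard
    obtain ⟨B, hB⟩ := Finset.card_eq_one.1 (show π.parts.card = 1 by omega)
    have hBu : B = Finset.univ := Finset.eq_univ_of_forall fun x => by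
      have := SetPartition.part_mem_parts π x
      rw [hB, Finset.mem_singleton] at this
      rw [← this]
      exact SetPartition.self_mem_part π x
    exact hne (Finpartition.ext (by rw [hB, hBu]; rfl))
  · exact fun h => absurd (mem_NC.2 (isNonCrossing_indiscrete huniv)) h

/-! ### Scaling and identification of indeterminates -/

theorem genCoeff_smul (c : ℂ) (f : Theta ι) (w : Fin n → ι) (π : SetPartition n) :
    genCoeff (c • f) w π = c ^ π.parts.card * genCoeff f w π := by
  simp only [genCoeff, coeff_smul, Finset.prod_mul_distrib, Finset.prod_const]

theorem genCoeff_dilate (α : ℂ) (f : Theta ι) (w : Fin n → ι) (π : SetPartition n) :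
    genCoeff (dilate α f) w π = α ^ n * genCoeff f w π := by
  rw [dilate, genCoeff_mkSeries, Finset.prod_mul_distrib, Finset.prod_pow_eq_pow_sum,
    π.sum_card_parts, Finset.card_univ, Fintype.card_fin]
  rfl

theorem SetPartition.bijective_orderEmbOfFin (π : SetPartition n) : Function.Bijective
    fun x : (B : π.parts) × Fin B.1.card => x.1.1.orderEmbOfFin rfl x.2 := by
  constructor
  · rintro ⟨B, s⟩ ⟨C, t⟩ h
    have hBC : B = C := Subtype.ext (π.eq_of_mem_parts B.2 C.2 (B.1.orderEmbOfFin_mem rfl s)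
      (by
        have := C.1.orderEmbOfFin_mem rfl t
        rwa [← show B.1.orderEmbOfFin rfl s = C.1.orderEmbOfFin rfl t from h] at this))
    subst hBC
    exact congrArg (Sigma.mk B) ((B.1.orderEmbOfFin rfl).injective h)
  · intro x
    obtain ⟨t, ht⟩ := exists_orderEmbOfFin_eq (π.self_mem_part x)
    exact ⟨⟨⟨π.part x, π.part_mem_parts x⟩, t⟩, ht⟩

theorem coeff_substVars [Fintype ι] [DecidableEq κ] (q : ι → κ) (F : Theta ι) (hn : n ≠ 0)
    (r : Fin n → κ) :
    coeff (substVars q F) r = ∑ v : Fin n → ι with (fun k => q (v k)) = r, coeff F v :=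
  coeff_mkSeries _ hn r

/-- Since the blocks partition the positions, a word over r amounts to an independent choice of a
word on each block. -/
theorem genCoeff_substVars [Fintype ι] [DecidableEq κ] (q : ι → κ) (F : Theta ι)
    (r : Fin n → κ) (π : SetPartition n) :
    genCoeff (substVars q F) r π =
      ∑ v : Fin n → ι with (fun k => q (v k)) = r, genCoeff F v π := by
  classical
  rw [substVars, genCoeff_mkSeries,
    ← Finset.prod_coe_sort π.parts fun B =>
      ∑ v : Fin B.card → ι with (fun k => q (v k)) = restrictWord r B, coeff F v,
    Finset.prod_univ_sum]
  symm
  let e := Equiv.ofBijective _ π.bijective_orderEmbOfFin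
  have he : ∀ (B : π.parts) (t : Fin B.1.card), e.symm (B.1.orderEmbOfFin rfl t) = ⟨B, t⟩ :=
    fun B t => e.symm_apply_apply ⟨B, t⟩
  refine Finset.sum_bij' (fun v _ B => restrictWord v B.1)
    (fun u _ x => u (e.symm x).1 (e.symm x).2) ?_ ?_ ?_ ?_ ?_
  · intro v hv
    simp only [Finset.mem_filter, Finset.mem_univ, true_and, Fintype.mem_piFinset] at hv ⊢
    intro B
    rw [← hv]
    rfl
  · intro u hu
    simp only [Finset.mem_filter, Finset.mem_univ, true_and, Fintype.mem_piFinset] at hu ⊢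
    funext x
    obtain ⟨y, rfl⟩ := e.surjective x
    rw [e.symm_apply_apply]
    exact congrFun (hu y.1) y.2
  · intro v _
    funext x
    exact congrArg v (e.apply_symm_apply x)
  · intro u _
    funext B t
    simp only [restrictWord]
    rw [he]
  · intro v _
    exact (Finset.prod_coe_sort π.parts fun B => coeff F (restrictWord v B)).symm

/-- Möbius coefficients depend only on block sizes, so they may be read in either set of
indeterminates. The scalars match because |π| = 1 + n - |Kr(π)|: the factor c to the power |Kr(π)|
comes from the multiple of the series, c to the power -n from the dilation. -/
theorem conv_smul_substVars_moebSeries [Fintype ι] [DecidableEq κ] {c : ℂ} (hc : c ≠ 0)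
    (q : ι → κ) (p : ι → δ) (F : Theta ι) :
    conv id ((1 / c) • substVars q F) (moebSeries κ) =
      (1 / c) • substVars q (conv p F (c • dilate (1 / c) (moebSeries δ))) := by
  refine Theta.ext_coeff fun n r hn => ?_
  rw [coeff_conv _ _ _ hn, coeff_smul, coeff_substVars _ _ hn]
  simp only [coeff_conv _ _ _ hn]
  rw [Finset.sum_comm, Finset.mul_sum]
  refine Finset.sum_congr rfl fun π hπ => ?_
  rw [genCoeff_smul, genCoeff_substVars, genCoeff_moebSeries, Finset.mul_sum, Finset.sum_mul,
    Finset.mul_sum]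
  refine Finset.sum_congr rfl fun v _ => ?_
  rw [genCoeff_smul, genCoeff_dilate, genCoeff_moebSeries]
  obtain ⟨m, rfl⟩ := Nat.exists_eq_add_one_of_ne_zero hn
  have hcard := card_parts_add_card_kreweras_parts (mem_NC.1 hπ)
  have hpow : (1 / c) ^ π.parts.card =
      1 / c * (c ^ (kreweras π).parts.card * (1 / c) ^ (m + 1)) := by
    have h1 : (1 / c) ^ (kreweras π).parts.card * c ^ (kreweras π).parts.card = 1 := by
      rw [← mul_pow, one_div_mul_cancel hc, one_pow]
    calc (1 / c) ^ π.parts.card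
        = (1 / c) ^ π.parts.card *
            ((1 / c) ^ (kreweras π).parts.card * c ^ (kreweras π).parts.card) := by
          rw [h1, mul_one]
      _ = (1 / c) ^ (π.parts.card + (kreweras π).parts.card) *
            c ^ (kreweras π).parts.card := by
          rw [pow_add]
          ring
      _ = _ := by
          rw [hcard, pow_succ]
          ring
  rw [hpow]
  ring

end

end FreeProb

namespace FreeProb

noncomputable section

variable {ι κ : Type*} {n d : ℕ}

open SetPartition

/-! ### R-cyclic families -/

theorem genCoeff_geomSeries_of_forall {u : Fin n → Fin d} {τ : SetPartition n}
    (h : ∀ x y, τ.part x = τ.part y → u x = u y) : genCoeff (geomSeries d) u τ = 1 := by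
  rw [geomSeries, genCoeff_mkSeries]
  refine Finset.prod_eq_one fun B hB => if_pos ?_
  obtain ⟨x, hx⟩ := τ.nonempty_of_mem_parts hB
  exact ⟨u x, fun k => h _ _ (τ.part_eq_part_of_mem hB (B.orderEmbOfFin_mem rfl k) hx)⟩

theorem genCoeff_geomSeries_of_ne {u : Fin n → Fin d} {τ : SetPartition n} {x y : Fin n}
    (hxy : τ.part x = τ.part y) (hne : u x ≠ u y) : genCoeff (geomSeries d) u τ = 0 := by
  rw [geomSeries, genCoeff_mkSeries]
  refine Finset.prod_eq_zero (τ.part_mem_parts x) (if_neg ?_)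
  rintro ⟨i, hi⟩
  obtain ⟨s, hs⟩ := exists_orderEmbOfFin_eq (τ.self_mem_part x)
  obtain ⟨t, ht⟩ := exists_orderEmbOfFin_eq (τ.mem_part_iff.2 hxy.symm)
  have h1 := hi s
  have h2 := hi t
  simp only [restrictWord, hs, ht] at h1 h2
  exact hne (h1.trans h2.symm)

/-- The cumulant functional of the entries of an R-cyclic family, read along a closed path of
indices, in terms of the determining series. -/
theorem genCoeff_closedPath {E : Type*} (R : Theta E) (e : κ → Fin d → Fin d → E)
    (hcyc : ∀ n : ℕ, 1 ≤ n → ∀ (r : Fin n → κ) (i j : Fin n → Fin d),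
      ¬ (∀ k, j k = i (finRotate n k)) → coeff R (fun k => e (r k) (i k) (j k)) = 0)
    (q : ι → κ) (p : ι → Fin d) (f : Theta ι)
    (hf : ∀ (n : ℕ) (w : Fin n → ι), n ≠ 0 → coeff f w =
      coeff R fun k => e (q (w k)) (p (w ((finRotate n).symm k))) (p (w k)))
    (w : Fin n → ι) (π : SetPartition n) :
    genCoeff R (fun k => e (q (w k)) (p (w ((finRotate n).symm k))) (p (w k))) π =
      genCoeff f w π * genCoeff (geomSeries d) (fun k => p (w k)) (kreweras π) := by
  have hsc : ∀ k, (kreweras π).part k =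
      (kreweras π).part (((partitionPerm π)⁻¹ * finRotate n) k) := fun k => by
    rw [kreweras, cyclePartition_part_eq_iff]
    exact ⟨1, by simp⟩
  -- Either the index word is constant along the cycles defining Kr(π), or both sides vanish.
  by_cases h : ∀ k, p (w k) = p (w (((partitionPerm π)⁻¹ * finRotate n) k))
  · rw [genCoeff_geomSeries_of_forall, mul_one]
    · refine Finset.prod_congr rfl fun B hB => ?_
      rw [hf _ _ (card_pos_of_mem_parts π hB)]
      congr 1
      funext t
      simp only [restrictWord]
      congr 1
      -- The index just before position b in the whole word equals the one at P_π⁻¹ b, the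
      -- predecessor of b within its block.
      have := h ((finRotate n).symm (B.orderEmbOfFin rfl t))
      rw [this, Equiv.Perm.mul_apply, Equiv.apply_symm_apply, Equiv.Perm.inv_eq_iff_eq.2]
      rw [partitionPerm_orderEmbOfFin π hB, Equiv.apply_symm_apply]
    · intro x y hxy
      rw [kreweras, cyclePartition_part_eq_iff] at hxy
      obtain ⟨i, -, rfl⟩ := hxy.exists_pow_eq'
      clear hxy
      induction i with
      | zero => rfl
      | succ i ih =>
        rw [pow_succ', Equiv.Perm.mul_apply]
        exact ih.trans (h _)
  · push Not at h
    obtain ⟨k, hk⟩ := h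
    rw [genCoeff_geomSeries_of_ne (hsc k) hk, mul_zero]
    -- In its block, x is followed by the position after k, so a nonzero cumulant there would force
    -- the indices at x and k to agree.
    set x := ((partitionPerm π)⁻¹ * finRotate n) k with hx
    have hPx : partitionPerm π x = finRotate n k := by simp [hx]
    have hB := π.part_mem_parts x
    obtain ⟨t, ht⟩ := exists_orderEmbOfFin_eq (π.self_mem_part x)
    have hrot := partitionPerm_orderEmbOfFin π hB t
    refine Finset.prod_eq_zero hB ?_
    refine hcyc _ (Nat.one_le_iff_ne_zero.2 (card_pos_of_mem_parts π hB))
      (fun s => q (w ((π.part x).orderEmbOfFin rfl s)))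
      (fun s => p (w ((finRotate n).symm ((π.part x).orderEmbOfFin rfl s))))
      (fun s => p (w ((π.part x).orderEmbOfFin rfl s))) fun hall => hk ?_
    have := hall t
    rw [← hrot, ht, hPx, Equiv.symm_apply_apply] at this
    exact this.symm

/-! ### Traces of matrix products as sums over closed paths -/

variable {A : Type*} [Ring A]

/-- The path starts at i and then runs through v. Keeping the endpoint as a condition, rather than
fixing the last vertex, lets the induction peel off the first factor. -/
theorem list_prod_ofFn_apply (M : Fin n → Matrix (Fin d) (Fin d) A) (i j : Fin d) :
    (List.ofFn M).prod i j = ∑ v : Fin n → Fin d,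
      if (Fin.cons i v : Fin (n + 1) → Fin d) (Fin.last n) = j then
        (List.ofFn fun k => M k ((Fin.cons i v : Fin (n + 1) → Fin d) k.castSucc) (v k)).prod
      else 0 := by
  induction n generalizing i with
  | zero => simp [Matrix.one_apply]
  | succ n ih =>
    rw [List.ofFn_succ, List.prod_cons, Matrix.mul_apply,
      ← (Fin.consEquiv fun _ => Fin d).sum_comp, Fintype.sum_prod_type]
    refine Finset.sum_congr rfl fun l _ => ?_
    rw [ih, Finset.mul_sum]
    refine Finset.sum_congr rfl fun v _ => ?_
    rw [mul_ite, mul_zero]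
    simp only [Fin.consEquiv, Equiv.coe_fn_mk, List.ofFn_succ, List.prod_cons, ← Fin.succ_last,
      Fin.cons_succ, Fin.castSucc_zero, Fin.cons_zero, ← Fin.succ_castSucc]

theorem sum_list_prod_ofFn_apply (hn : n ≠ 0) (M : Fin n → Matrix (Fin d) (Fin d) A) :
    ∑ i, (List.ofFn M).prod i i = ∑ v : Fin n → Fin d,
      (List.ofFn fun k => M k (v ((finRotate n).symm k)) (v k)).prod := by
  obtain ⟨m, rfl⟩ := Nat.exists_eq_add_one_of_ne_zero hn
  simp only [list_prod_ofFn_apply]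
  rw [Finset.sum_comm]
  refine Finset.sum_congr rfl fun v _ => ?_
  simp only [← Fin.succ_last, Fin.cons_succ]
  rw [Finset.sum_ite_eq, if_pos (Finset.mem_univ _)]
  congr 2
  funext k
  congr 1
  obtain ⟨l, rfl⟩ := (finRotate (m + 1)).surjective k
  rw [Equiv.symm_apply_apply]
  induction l using Fin.lastCases with
  | last => rw [finRotate_last]; rfl
  | cast l =>
    rw [finRotate_castSucc, ← Fin.succ_castSucc, Fin.cons_succ]

/-! ### The moment-cumulant formula -/

variable [Algebra ℂ A]

/-- By associativity, (M ⋆ Möb) ⋆ Zeta = M ⋆ Δ. -/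
theorem conv_rTransform_zetaSeries (φ : A →ₗ[ℂ] ℂ) (a : ι → A) :
    conv id (rTransform φ a) (zetaSeries ι) = momentSeries φ a := by
  rw [rTransform, boxConv_eq_conv, conv_assoc, ← boxConv_eq_conv (moebSeries ι),
    moebSeries_boxConv_zetaSeries, conv_deltaSeries]

theorem apply_list_prod_eq_sum_genCoeff (φ : A →ₗ[ℂ] ℂ) (a : ι → A) (hn : n ≠ 0)
    (w : Fin n → ι) :
    φ (List.ofFn fun k => a (w k)).prod = ∑ π ∈ NC n, genCoeff (rTransform φ a) w π := by
  have h : coeff (momentSeries φ a) w = φ (List.ofFn fun k => a (w k)).prod :=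
    coeff_mkSeries _ hn w
  rw [← h, ← conv_rTransform_zetaSeries, coeff_conv _ _ _ hn]
  simp only [genCoeff_zetaSeries, mul_one]

theorem coeff_familyDeterminingSeries (φ : A →ₗ[ℂ] ℂ) {s : ℕ}
    (X : Fin s → Matrix (Fin d) (Fin d) A) (w : Fin n → Fin s × Fin d) (hn : n ≠ 0) :
    coeff (familyDeterminingSeries φ X) w = coeff (familyEntryRTransform φ X) fun k =>
      ((w k).1, (w ((finRotate n).symm k)).2, (w k).2) := by
  rw [familyDeterminingSeries, coeff_mkSeries _ hn]

theorem coeff_determiningSeries (φ : A →ₗ[ℂ] ℂ) (X : Matrix (Fin d) (Fin d) A)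
    (w : Fin n → Fin d) (hn : n ≠ 0) :
    coeff (determiningSeries φ X) w = coeff (entryRTransform φ X) fun k =>
      (w ((finRotate n).symm k), w k) := by
  rw [determiningSeries, coeff_mkSeries _ hn]

/-! ### Families and single matrices treated together -/

section Generic

variable {E : Type*} [Fintype ι] [DecidableEq κ] (φ : A →ₗ[ℂ] ℂ) (a : E → A)
  (e : κ → Fin d → Fin d → E) (X : κ → Matrix (Fin d) (Fin d) A)
  (q : ι → κ) (p : ι → Fin d) (f : Theta ι)

/-- An indeterminate x stands for the matrix `q x` and the index `p x`. Bijectivity of the pairing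
makes the index paths, for given matrices, the same as the words lying over r. -/
theorem momentSeries_eq_substVars (hX : ∀ r i j, a (e r i j) = X r i j)
    (hqp : Function.Bijective fun x => (q x, p x))
    (hcyc : ∀ n : ℕ, 1 ≤ n → ∀ (r : Fin n → κ) (i j : Fin n → Fin d),
      ¬ (∀ k, j k = i (finRotate n k)) →
        coeff (rTransform φ a) (fun k => e (r k) (i k) (j k)) = 0)
    (hf : ∀ (n : ℕ) (w : Fin n → ι), n ≠ 0 → coeff f w =
      coeff (rTransform φ a) fun k => e (q (w k)) (p (w ((finRotate n).symm k))) (p (w k))) :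
    momentSeries (matrixExpectation φ d) X =
      (1 / (d : ℂ)) • substVars q (conv p f (geomSeries d)) := by
  refine Theta.ext_coeff fun n r hn => ?_
  rw [coeff_smul, momentSeries, coeff_mkSeries _ hn, coeff_substVars _ _ hn]
  change (1 / (d : ℂ)) * ∑ i, φ ((List.ofFn fun k => X (r k)).prod i i) = _
  rw [← map_sum, sum_list_prod_ofFn_apply hn, map_sum]
  congr 1
  let c := Equiv.ofBijective _ hqp
  have hc1 : ∀ y, q (c.symm y) = y.1 := fun y => congrArg Prod.fst (c.apply_symm_apply y)
  have hc2 : ∀ y, p (c.symm y) = y.2 := fun y => congrArg Prod.snd (c.apply_symm_apply y)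
  refine Finset.sum_bij' (fun v _ k => c.symm (r k, v k)) (fun w _ k => p (w k)) ?_ ?_ ?_ ?_ ?_
  · intro v _
    simp [hc1]
  · exact fun _ _ => Finset.mem_univ _
  · intro v _
    simp [hc2]
  · intro w hw
    obtain rfl := (Finset.mem_filter.1 hw).2
    funext k
    exact c.symm_apply_apply (w k)
  · intro v _
    rw [coeff_conv _ _ _ hn]
    simp only [← genCoeff_closedPath (rTransform φ a) e hcyc q p f hf]
    rw [← apply_list_prod_eq_sum_genCoeff φ a hn]
    simp only [hX, hc1, hc2]

theorem rTransform_eq_substVars (hd : 0 < d)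
    (hM : momentSeries (matrixExpectation φ d) X =
      (1 / (d : ℂ)) • substVars q (conv p f (geomSeries d))) :
    rTransform (matrixExpectation φ d) X =
      (1 / (d : ℂ)) • substVars q (conv p f (hSeries d)) := by
  rw [rTransform, hM, boxConv_eq_conv,
    conv_smul_substVars_moebSeries (Nat.cast_ne_zero.2 hd.ne') q p, conv_assoc]
  rfl

end Generic

end

end FreeProb

theorem theorem2p10 {A : Type*} [Ring A] [Algebra ℂ A] (φ : A →ₗ[ℂ] ℂ) (hφ : φ 1 = 1)
    (d : ℕ) (hd : 0 < d) :
    (∀ (s : ℕ) (X : Fin s → Matrix (Fin d) (Fin d) A), FreeProb.IsRCyclicFamily φ X →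
      FreeProb.momentSeries (FreeProb.matrixExpectation φ d) X =
          (1 / (d : ℂ)) • FreeProb.substVars Prod.fst
            (FreeProb.extBoxConv (FreeProb.familyDeterminingSeries φ X) (FreeProb.geomSeries d)) ∧
      FreeProb.rTransform (FreeProb.matrixExpectation φ d) X =
          (1 / (d : ℂ)) • FreeProb.substVars Prod.fst
            (FreeProb.extBoxConv (FreeProb.familyDeterminingSeries φ X) (FreeProb.hSeries d))) ∧
    (∀ X : Matrix (Fin d) (Fin d) A, FreeProb.IsRCyclic φ X →
      FreeProb.momentSeries (FreeProb.matrixExpectation φ d) (fun _ : Fin 1 => X) =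
          (1 / (d : ℂ)) • FreeProb.substVars (fun _ => (0 : Fin 1))
            (FreeProb.boxConv (FreeProb.determiningSeries φ X) (FreeProb.geomSeries d)) ∧
      FreeProb.rTransform (FreeProb.matrixExpectation φ d) (fun _ : Fin 1 => X) =
          (1 / (d : ℂ)) • FreeProb.substVars (fun _ => (0 : Fin 1))
            (FreeProb.boxConv (FreeProb.determiningSeries φ X) (FreeProb.hSeries d))) := by
  refine ⟨fun s X hX => ?_, fun X hX => ?_⟩
  -- By unfolding, the extended convolution is `conv Prod.snd`, and the ordinary one, used for a
  -- single matrix, is `conv id`.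
  · have hM := FreeProb.momentSeries_eq_substVars φ
      (fun x : Fin s × Fin d × Fin d => X x.1 x.2.1 x.2.2) (fun r i j => (r, i, j)) X Prod.fst
      Prod.snd (FreeProb.familyDeterminingSeries φ X) (fun _ _ _ => rfl)
      (by exact Function.bijective_id) (by exact hX)
      (by exact fun _ w hn => FreeProb.coeff_familyDeterminingSeries φ X w hn)
    exact ⟨hM, FreeProb.rTransform_eq_substVars φ X Prod.fst Prod.snd _ hd hM⟩
  · have hM := FreeProb.momentSeries_eq_substVars φ (fun x : Fin d × Fin d => X x.1 x.2)
      (fun _ i j => (i, j)) (fun _ : Fin 1 => X) (fun _ => 0) id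
      (FreeProb.determiningSeries φ X) (fun _ _ _ => rfl)
      ⟨fun _ _ h => (Prod.mk.inj h).2, fun y => ⟨y.2, Prod.ext (Subsingleton.elim _ _) rfl⟩⟩
      (by exact fun n hn _ => hX n hn)
      (by exact fun _ w hn => FreeProb.coeff_determiningSeries φ X w hn)
    exact ⟨hM, FreeProb.rTransform_eq_substVars φ _ _ id _ hd hM⟩
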